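/- Let $Q=(0,1)_t\times(0,1)_x$ be the open unit square and let $\partial_0Q=\{0\}\times(0,1)\,\cup\,(0,1)\times\{0,1\}$ be its parabolic boundary. Let $t_1\in[0,1)$ and $L\ge 1$. There exists a constant $C>0$, depending only on $L$ and $t_1$, such that the following holds. Let $h:\overline Q\to\mathbb R$ be Lipschitz with $\mathrm{Lip}(h)\le L$ (with respect to the Euclidean distance) and satisfy $$\partial_t h+\tfrac12(\partial_x h)^2=0\qquad\text{a.e. in }Q,$$ and suppose that, with $u=\partial_x h$, the distribution $\mu=\partial_t\frac{u^2}{2}+\partial_x\frac{u^3}{3}$ is a (signed) Radon measure in $Q$. Then there is exactly one viscosity solution $\bar h\in C(\overline Q)$ of $$\partial_t\bar h+\tfrac12(\partial_x\bar h)^2=0\ \text{ in }Q,\qquad \bar h=h\ \text{ on }\partial_0Q,$$ and it satisfies $$\sup_{Q\cap\{t\le t_1\}}|h-\bar h|\le C\,\|\mu_+\|^{1/8},$$ where $\mu_+$ is the positive part in the Jordan decomposition of $\mu$ and $\|\mu_+\|=\mu_+(Q)\in[0,\infty]$ is its total mass (the estimate being void if $\|\mu_+\|=\infty$). -/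

import Mathlib

open Set MeasureTheory
open scoped ContDiff

noncomputable section

namespace BurgersHJ

/-- The open unit square `Q = (0,1)_t × (0,1)_x`; points of the plane are `z = (t, x)`. -/
def Q : Set (ℝ × ℝ) := Ioo 0 1 ×ˢ Ioo 0 1

/-- The parabolic boundary `{0} × (0,1) ∪ (0,1) × {0,1}` of `Q`. -/
def parabolicBoundary : Set (ℝ × ℝ) :=
  ({0} ×ˢ Ioo 0 1) ∪ (Ioo 0 1 ×ˢ {0, 1})

/-- The partial derivative in time. For a locally Lipschitz `f` it is the genuine partial derivative
at almost every point, by Rademacher's theorem. -/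
def dt (f : ℝ × ℝ → ℝ) (z : ℝ × ℝ) : ℝ := fderiv ℝ f z (1, 0)

/-- The partial derivative in space. -/
def dx (f : ℝ × ℝ → ℝ) (z : ℝ × ℝ) : ℝ := fderiv ℝ f z (0, 1)

/-- `f` is `L`-Lipschitz on `S` with respect to the Euclidean distance of the plane
(the distance of the type `ℝ × ℝ` itself is the maximum distance). -/
def EuclideanLipschitzOn (L : ℝ) (f : ℝ × ℝ → ℝ) (S : Set (ℝ × ℝ)) : Prop :=
  ∀ z ∈ S, ∀ w ∈ S, |f z - f w| ≤ L * Real.sqrt ((z.1 - w.1) ^ 2 + (z.2 - w.2) ^ 2)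

/-- `∂ₜ h + ½ (∂ₓ h)² = 0` almost everywhere in `U`. -/
def SolvesHJAE (U : Set (ℝ × ℝ)) (h : ℝ × ℝ → ℝ) : Prop :=
  ∀ᵐ z ∂(volume.restrict U), dt h z + (1 / 2) * (dx h z) ^ 2 = 0

/-- `v` is a viscosity subsolution of `∂ₜ v + ½ (∂ₓ v)² ≤ 0` in the open set `U`. -/
def IsViscositySubsolution (U : Set (ℝ × ℝ)) (v : ℝ × ℝ → ℝ) : Prop :=
  ContinuousOn v U ∧
    ∀ z ∈ U, ∀ φ : ℝ × ℝ → ℝ, ContDiffAt ℝ 1 φ z → IsLocalMax (fun w => v w - φ w) z →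
      dt φ z + (1 / 2) * (dx φ z) ^ 2 ≤ 0

/-- `v` is a viscosity supersolution of `∂ₜ v + ½ (∂ₓ v)² ≥ 0` in the open set `U`. -/
def IsViscositySupersolution (U : Set (ℝ × ℝ)) (v : ℝ × ℝ → ℝ) : Prop :=
  ContinuousOn v U ∧
    ∀ z ∈ U, ∀ φ : ℝ × ℝ → ℝ, ContDiffAt ℝ 1 φ z → IsLocalMin (fun w => v w - φ w) z →
      0 ≤ dt φ z + (1 / 2) * (dx φ z) ^ 2

/-- `v`, continuous on the closed square, is a viscosity solution of `∂ₜ v + ½ (∂ₓ v)² = 0` in `Q`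
with `v = h` on the parabolic boundary. Values outside the closed square play no role. -/
structure IsViscositySolutionWithData (h v : ℝ × ℝ → ℝ) : Prop where
  continuousOn : ContinuousOn v (closure Q)
  sub : IsViscositySubsolution Q v
  super : IsViscositySupersolution Q v
  boundary : ∀ z ∈ parabolicBoundary, v z = h z

/-- A (signed, real-valued, not necessarily finite) Radon measure in the open set `U`, given by its
Jordan decomposition: two mutually singular positive Borel measures carried by `U`, each finite on
the compact subsets of `U`. In particular `posPart U` is the total mass of the positive part. -/
structure SignedRadonMeasure (U : Set (ℝ × ℝ)) where
  posPart : Measure (ℝ × ℝ)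
  negPart : Measure (ℝ × ℝ)
  posPart_compl : posPart Uᶜ = 0
  negPart_compl : negPart Uᶜ = 0
  posPart_lt_top : ∀ K ⊆ U, IsCompact K → posPart K < ⊤
  negPart_lt_top : ∀ K ⊆ U, IsCompact K → negPart K < ⊤
  mutuallySingular : posPart.MutuallySingular negPart

/-- The integral of a test function (continuous with compact support in `U`) against `μ`. -/
def SignedRadonMeasure.integral {U : Set (ℝ × ℝ)} (μ : SignedRadonMeasure U)
    (φ : ℝ × ℝ → ℝ) : ℝ :=
  (∫ z, φ z ∂μ.posPart) - ∫ z, φ z ∂μ.negPart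

/-- `μ = ∂ₜ (u² / 2) + ∂ₓ (u³ / 3)` in the sense of distributions in `U`. -/
def IsEntropyProduction (U : Set (ℝ × ℝ)) (u : ℝ × ℝ → ℝ) (μ : SignedRadonMeasure U) : Prop :=
  ∀ φ : ℝ × ℝ → ℝ, ContDiff ℝ ∞ φ → HasCompactSupport φ → tsupport φ ⊆ U →
    μ.integral φ = -∫ z in U, ((u z) ^ 2 / 2 * dt φ z + (u z) ^ 3 / 3 * dx φ z)

end BurgersHJ

end

/-! ### The unit square, and the bound of `h` by the action of straight lines. -/

namespace BurgersHJ

/-! For every speed `q`, an almost-everywhere solution satisfies `∂ₜh + q ∂ₓh ≤ q²/2`. Hence `h`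
lies below the cost of every straight line (`SolvesHJAE.le_action`), and so below the Hopf–Lax
function `h̄` of its own boundary values. Dynamic programming makes `h̄` a Lipschitz viscosity
solution, and doubling of variables makes it the only one. Only an upper bound for `h̄ - h` remains.

Suppose `h̄ - h = m > 0` at a point of time at most `t₁`, and put `θ = 1 - t₁`. Doubling of
variables with a penalty in time (`exists_touching_paraboloid`) yields a paraboloid of scale `ε`
that touches `h` from below at some `z₀`, with a slope `p` such that `p₁ + p₂²/2 ≤ -lam`, where `lam
= m θ / 2`. So `h` violates the supersolution property by a definite amount, and this must produce
entropy.

To see it, make the paraboloid twice as curved, raise it by `η`, and test `μ` with the positive part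
`W` of its difference to `h` (`sq_mul_sq_le_of_touching`). `W` is only Lipschitz, so the entropy
identity is first extended to such functions by mollification
(`IsEntropyProduction.integral_eq_of_lipschitz`). Where `W > 0`, the integrand is `(k - u)⁴/12 + δ²`
up to small errors, with `k = p₂` and defect `δ ≥ lam` (`defect_sq_le`). As `W > 0` on a square of
side comparable to `η`, this gives `lam² η² ≲ ∫ W dμ ≤ η ‖μ₊‖`.

The choices `ε ∼ m θ` and `η ∼ lam⁴ ε` turn `lam² η ≲ ‖μ₊‖` into `(m θ)⁷ ≲ ‖μ₊‖`. The a priori bound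
`m ≤ 3 L` converts the seventh power into the eighth. -/

theorem closure_Q : closure Q = Icc (0 : ℝ) 1 ×ˢ Icc (0 : ℝ) 1 := by
  rw [Q, closure_prod_eq, closure_Ioo zero_ne_one]

theorem mem_closure_Q {z : ℝ × ℝ} :
    z ∈ closure Q ↔ (0 ≤ z.1 ∧ z.1 ≤ 1) ∧ 0 ≤ z.2 ∧ z.2 ≤ 1 := by
  rw [closure_Q]; rfl

theorem mem_Q {z : ℝ × ℝ} : z ∈ Q ↔ (0 < z.1 ∧ z.1 < 1) ∧ 0 < z.2 ∧ z.2 < 1 := Iff.rfl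

theorem isOpen_Q : IsOpen Q := isOpen_Ioo.prod isOpen_Ioo

theorem convex_Q : Convex ℝ Q := (convex_Ioo 0 1).prod (convex_Ioo 0 1)

theorem isCompact_closure_Q : IsCompact (closure Q) := by
  rw [closure_Q]; exact isCompact_Icc.prod isCompact_Icc

variable {L : ℝ} {h : ℝ × ℝ → ℝ}

theorem EuclideanLipschitzOn.abs_sub_le {S : Set (ℝ × ℝ)} (hh : EuclideanLipschitzOn L h S)
    (hL : 0 ≤ L) {z w : ℝ × ℝ} (hz : z ∈ S) (hw : w ∈ S) :
    |h z - h w| ≤ L * (|z.1 - w.1| + |z.2 - w.2|) := by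
  refine (hh z hz w hw).trans (mul_le_mul_of_nonneg_left ?_ hL)
  refine Real.sqrt_le_iff.2 ⟨by positivity, ?_⟩
  have := mul_nonneg (abs_nonneg (z.1 - w.1)) (abs_nonneg (z.2 - w.2))
  nlinarith [sq_abs (z.1 - w.1), sq_abs (z.2 - w.2)]

theorem EuclideanLipschitzOn.le_add {S : Set (ℝ × ℝ)} (hh : EuclideanLipschitzOn L h S)
    (hL : 0 ≤ L) {z w : ℝ × ℝ} (hz : z ∈ S) (hw : w ∈ S) :
    h z ≤ h w + L * (|z.1 - w.1| + |z.2 - w.2|) := by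
  have := (abs_le.1 (hh.abs_sub_le hL hz hw)).2
  linarith

/-- The factor 2 comes from bounding the Euclidean norm by the sum of the coordinates, each at most
the maximum norm. -/
theorem EuclideanLipschitzOn.lipschitzOnWith {S : Set (ℝ × ℝ)} (hh : EuclideanLipschitzOn L h S)
    (hL : 0 ≤ L) : LipschitzOnWith (2 * L).toNNReal h S := by
  refine LipschitzOnWith.of_dist_le_mul fun z hz w hw => ?_
  rw [Real.coe_toNNReal _ (by positivity), Real.dist_eq]
  refine (hh.abs_sub_le hL hz hw).trans ?_
  have h1 : |z.1 - w.1| ≤ dist z w := by rw [← Real.dist_eq]; exact le_max_left _ _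
  have h2 : |z.2 - w.2| ≤ dist z w := by rw [← Real.dist_eq]; exact le_max_right _ _
  nlinarith

theorem fderiv_congr_on_Q {H : ℝ × ℝ → ℝ} (hH : EqOn h H (closure Q)) {z : ℝ × ℝ} (hz : z ∈ Q) :
    fderiv ℝ H z = fderiv ℝ h z :=
  Filter.EventuallyEq.fderiv_eq <| Filter.eventually_of_mem (isOpen_Q.mem_nhds hz)
    fun _ hw => (hH (subset_closure hw)).symm

theorem fderiv_apply_eq (f : ℝ × ℝ → ℝ) (z v : ℝ × ℝ) :
    fderiv ℝ f z v = v.1 * dt f z + v.2 * dx f z := by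
  have : v = v.1 • ((1 : ℝ), (0 : ℝ)) + v.2 • ((0 : ℝ), (1 : ℝ)) := by ext <;> simp
  conv_lhs => rw [this]
  rw [map_add, map_smul, map_smul]; rfl

/-- A Lipschitz almost-everywhere solution lies below the action of straight lines. -/
theorem SolvesHJAE.le_of_mem_Q (hL : 0 ≤ L) (hh : EuclideanLipschitzOn L h (closure Q))
    (hs : SolvesHJAE Q h) {z z' : ℝ × ℝ} (hz : z ∈ Q) (hz' : z' ∈ Q) (hlt : z.1 < z'.1) :
    h z' ≤ h z + (z'.2 - z.2) ^ 2 / (2 * (z'.1 - z.1)) := by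
  obtain ⟨H, hHlip, hHeq⟩ := (hh.lipschitzOnWith hL).extend_real
  set V := z' - z with hV
  have hV1 : 0 < V.1 := by simpa [hV] using hlt
  set c := V.2 ^ 2 / (2 * V.1) with hc
  change h z' ≤ h z + c
  by_contra! hcon
  set κ := (h z' - h z - c) / 2 with hκ
  have hκ0 : 0 < κ := by rw [hκ]; linarith
  have hcont : Continuous fun ζ => H (z' + ζ) - H (z + ζ) :=
    (hHlip.continuous.comp (by fun_prop)).sub (hHlip.continuous.comp (by fun_prop))
  have hopen : IsOpen {ζ : ℝ × ℝ | c + κ < H (z' + ζ) - H (z + ζ) ∧ z + ζ ∈ Q ∧ z' + ζ ∈ Q} :=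
    (isOpen_lt continuous_const hcont).inter
      ((isOpen_Q.preimage (by fun_prop)).inter (isOpen_Q.preimage (by fun_prop)))
  obtain ⟨r, hr, hball⟩ := Metric.isOpen_iff.1 hopen 0 (by
    simp only [mem_ofPred_eq, add_zero, hz, hz', and_self, and_true]
    rw [← hHeq (subset_closure hz), ← hHeq (subset_closure hz'), hκ]; linarith)
  set B : Set (ℝ × ℝ) := Metric.ball 0 r with hB
  have hBfin : volume B ≠ ⊤ := Metric.isBounded_ball.measure_lt_top.ne
  have hBpos : 0 < (volume B).toReal :=
    ENNReal.toReal_pos (Metric.measure_ball_pos volume 0 hr).ne' hBfin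
  have hint : ∀ a : ℝ × ℝ, IntegrableOn (fun ζ => H (a + ζ)) B := fun a =>
    ((hHlip.continuous.comp (by fun_prop : Continuous fun ζ : ℝ × ℝ => a + ζ)).continuousOn.integrableOn_compact
      (isCompact_closedBall 0 r)).mono_set Metric.ball_subset_closedBall
  have hdiff : ∀ a : ℝ × ℝ, ∀ᵐ ζ : ℝ × ℝ, DifferentiableAt ℝ H (a + ζ) := fun a =>
    (measurePreserving_add_left volume a).quasiMeasurePreserving.ae hHlip.ae_differentiableAt
  -- The equation may fail on all of a given segment, which is a null set. Averaging over the
  -- translates by `ζ ∈ B` makes the almost-everywhere information usable at every `σ`.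
  have hder : ∀ σ : ℝ, HasDerivAt (fun σ : ℝ => ∫ ζ in B, H (z + σ • V + ζ))
      (∫ ζ in B, fderiv ℝ H (z + σ • V + ζ) V) σ := by
    intro σ
    refine (hasDerivAt_integral_of_dominated_loc_of_lip (μ := volume.restrict B)
      (F := fun σ ζ => H (z + σ • V + ζ)) (bound := fun _ => (2 * L).toNNReal * ‖V‖)
      Filter.univ_mem ?_ (hint (z + σ • V)) ?_ ?_ ?_ ?_).2
    · exact Filter.Eventually.of_forall fun _ => (hint _).aestronglyMeasurable
    · exact ((measurable_fderiv_apply_const ℝ H V).comp (measurable_const_add _)).aestronglyMeasurable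
    · refine Filter.Eventually.of_forall fun ζ => ?_
      refine LipschitzOnWith.of_dist_le_mul fun a _ b _ => ?_
      refine (hHlip.dist_le_mul _ _).trans ?_
      rw [Real.coe_nnabs, abs_of_nonneg (by positivity), mul_assoc]
      refine mul_le_mul_of_nonneg_left ?_ (by positivity)
      rw [dist_add_right, dist_add_left, dist_eq_norm, ← sub_smul, norm_smul, mul_comm,
        dist_eq_norm]
    · exact integrableOn_const hBfin
    · refine ae_restrict_of_ae ?_
      filter_upwards [hdiff (z + σ • V)] with ζ hζ
      have h1 : HasDerivAt (fun σ : ℝ => z + σ • V + ζ) V σ := by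
        simpa using (((hasDerivAt_id σ).smul_const V).const_add z).add_const ζ
      exact hζ.hasFDerivAt.comp_hasDerivAt σ h1
  have hbound : ∀ σ ∈ Icc (0 : ℝ) 1,
      ∫ ζ in B, fderiv ℝ H (z + σ • V + ζ) V ≤ (volume B).toReal * c := by
    intro σ hσ
    have hmem : ∀ ζ ∈ B, z + σ • V + ζ ∈ Q := by
      intro ζ hζ
      have h1 := hball hζ
      have h2 := convex_Q h1.2.1 h1.2.2 (sub_nonneg.2 hσ.2) hσ.1 (by ring)
      convert h2 using 1
      rw [hV]; module
    have hae : ∀ᵐ ζ : ℝ × ℝ, z + σ • V + ζ ∈ Q →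
        dt h (z + σ • V + ζ) + (1 / 2) * (dx h (z + σ • V + ζ)) ^ 2 = 0 :=
      (measurePreserving_add_left volume (z + σ • V)).quasiMeasurePreserving.ae
        ((ae_restrict_iff' isOpen_Q.measurableSet).1 hs)
    have hle : ∀ᵐ ζ ∂(volume.restrict B), fderiv ℝ H (z + σ • V + ζ) V ≤ c := by
      refine (ae_restrict_iff' Metric.isOpen_ball.measurableSet).2 ?_
      filter_upwards [hae] with ζ hζ hζB
      have h1 := eq_neg_of_add_eq_zero_left (hζ (hmem ζ hζB))
      rw [fderiv_congr_on_Q hHeq (hmem ζ hζB), fderiv_apply_eq, hc, h1, le_div_iff₀ (by positivity)]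
      -- Young's inequality: `-V₁ u²/2 + V₂ u ≤ V₂²/(2 V₁)`.
      nlinarith [sq_nonneg (V.2 - V.1 * dx h (z + σ • V + ζ))]
    have hi : IntegrableOn (fun ζ => fderiv ℝ H (z + σ • V + ζ) V) B := by
      refine Measure.integrableOn_of_bounded (M := (2 * L).toNNReal * ‖V‖) hBfin
        ((measurable_fderiv_apply_const ℝ H V).comp
          (measurable_const_add _)).aestronglyMeasurable ?_
      refine Filter.Eventually.of_forall fun ζ => ?_
      exact ((fderiv ℝ H _).le_opNorm V).trans
        (mul_le_mul_of_nonneg_right (norm_fderiv_le_of_lipschitz ℝ hHlip) (norm_nonneg _))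
    have h3 := integral_mono_ae hi (integrableOn_const hBfin) hle
    simpa [Measure.real] using h3
  have hmv := (convex_Icc (0 : ℝ) 1).image_sub_le_mul_sub_of_deriv_le
    (f := fun σ : ℝ => ∫ ζ in B, H (z + σ • V + ζ))
    (fun σ _ => (hder σ).continuousAt.continuousWithinAt)
    (fun σ _ => (hder σ).differentiableAt.differentiableWithinAt)
    (C := (volume B).toReal * c)
    (fun σ hσ => by rw [(hder σ).deriv]; exact hbound σ (interior_subset hσ))
    0 (by simp) 1 (by simp) zero_le_one
  have hz'V : z + (1 : ℝ) • V = z' := by rw [hV]; module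
  simp only [hz'V, zero_smul, add_zero, sub_zero, mul_one] at hmv
  rw [← integral_sub (hint z') (hint z)] at hmv
  have hlow : (volume B).toReal * (c + κ) ≤ ∫ ζ in B, (H (z' + ζ) - H (z + ζ)) := by
    have h3 : ∫ _ζ in B, (c + κ) ≤ ∫ ζ in B, (H (z' + ζ) - H (z + ζ)) :=
      setIntegral_mono_on (integrableOn_const hBfin) ((hint z').sub (hint z))
        Metric.isOpen_ball.measurableSet fun ζ hζ => (hball hζ).1.le
    simpa [Measure.real] using h3
  nlinarith

/-- Both endpoints are contracted towards the centre of the square, which puts them in `Q` and keeps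
their time order; continuity does the rest. -/
theorem SolvesHJAE.le_action (hL : 0 ≤ L) (hh : EuclideanLipschitzOn L h (closure Q))
    (hs : SolvesHJAE Q h) {z z' : ℝ × ℝ} (hz : z ∈ closure Q) (hz' : z' ∈ closure Q)
    (hlt : z.1 < z'.1) :
    h z' ≤ h z + (z'.2 - z.2) ^ 2 / (2 * (z'.1 - z.1)) := by
  have hcont : ContinuousOn h (closure Q) := (hh.lipschitzOnWith hL).continuousOn
  let c : ℝ × ℝ := (1 / 2, 1 / 2)
  have hcl : IsClosed (closure Q) := isClosed_closure
  let f : ℝ × ℝ → ℝ → ℝ × ℝ := fun z δ => z + δ • (c - z)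
  have hf : ∀ z, Continuous (f z) := fun z => by fun_prop
  have hf0 : ∀ z, f z 0 = z := fun z => by simp [f]
  have hfQ : ∀ z ∈ closure Q, ∀ δ ∈ Ioo (0 : ℝ) 1, f z δ ∈ Q := by
    intro z hz δ hδ
    obtain ⟨⟨a1, a2⟩, a3, a4⟩ := mem_closure_Q.1 hz
    obtain ⟨b1, b2⟩ := hδ
    refine mem_Q.2 ⟨⟨?_, ?_⟩, ?_, ?_⟩ <;> simp only [f, c, Prod.fst_add, Prod.snd_add,
      Prod.smul_fst, Prod.smul_snd, Prod.fst_sub, Prod.snd_sub, smul_eq_mul] <;> nlinarith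
  have htend : ∀ z ∈ closure Q, Filter.Tendsto (fun δ => h (f z δ)) (nhdsWithin 0 (Ioo 0 1))
      (nhds (h z)) := by
    intro z hz
    have h1 : Filter.Tendsto (f z) (nhdsWithin 0 (Ioo 0 1)) (nhdsWithin z (closure Q)) := by
      refine tendsto_nhdsWithin_iff.2 ⟨?_, ?_⟩
      · have := ((hf z).tendsto 0).mono_left (nhdsWithin_le_nhds (s := Ioo 0 1))
        rwa [hf0] at this
      · filter_upwards [self_mem_nhdsWithin] with δ hδ
        exact subset_closure (hfQ z hz δ hδ)
    exact (hcont z hz).tendsto.comp h1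
  have hq : Filter.Tendsto (fun δ : ℝ => ((f z' δ).2 - (f z δ).2) ^ 2 /
      (2 * ((f z' δ).1 - (f z δ).1))) (nhdsWithin 0 (Ioo 0 1))
      (nhds ((z'.2 - z.2) ^ 2 / (2 * (z'.1 - z.1)))) := by
    have : ContinuousAt (fun δ : ℝ => ((f z' δ).2 - (f z δ).2) ^ 2 /
      (2 * ((f z' δ).1 - (f z δ).1))) 0 := by
      refine ContinuousAt.div (by fun_prop) (by fun_prop) ?_
      rw [hf0, hf0]; have := sub_pos.2 hlt; positivity
    have := this.tendsto.mono_left (nhdsWithin_le_nhds (s := Ioo 0 1))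
    simpa only [hf0] using this
  have : (nhdsWithin (0 : ℝ) (Ioo 0 1)).NeBot := by
    rw [← mem_closure_iff_nhdsWithin_neBot, closure_Ioo zero_ne_one]; simp
  refine le_of_tendsto_of_tendsto (htend z' hz') ((htend z hz).add hq) ?_
  filter_upwards [self_mem_nhdsWithin] with δ hδ
  refine hs.le_of_mem_Q hL hh (hfQ z hz δ hδ) (hfQ z' hz' δ hδ) ?_
  simp only [f, Prod.fst_add, Prod.smul_fst, Prod.fst_sub, smul_eq_mul]
  nlinarith [hδ.1, hδ.2]

end BurgersHJ

/-! ### The Hopf–Lax function is a viscosity solution with the given data. -/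

namespace BurgersHJ

/-- The closed parabolic boundary of `Q`. -/
def closedBoundary : Set (ℝ × ℝ) := {z | z ∈ closure Q ∧ (z.1 = 0 ∨ z.2 = 0 ∨ z.2 = 1)}

/-- The cost of reaching `z` along a straight line that starts at `ζ` with initial cost `h ζ`. -/
noncomputable def action (h : ℝ × ℝ → ℝ) (z ζ : ℝ × ℝ) : ℝ :=
  h ζ + (z.2 - ζ.2) ^ 2 / (2 * (z.1 - ζ.1))

/-- The boundary points from which `z` is reached with speed at most `Λ`. -/
def backwardCone (Λ : ℝ) (z : ℝ × ℝ) : Set (ℝ × ℝ) :=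
  {ζ | ζ ∈ closedBoundary ∧ |z.2 - ζ.2| ≤ Λ * (z.1 - ζ.1)}

/-- The Hopf–Lax formula with boundary data and speeds bounded by `Λ`. -/
noncomputable def hopfLax (h : ℝ × ℝ → ℝ) (Λ : ℝ) (z : ℝ × ℝ) : ℝ :=
  sInf (action h z '' backwardCone Λ z)

theorem mem_closedBoundary_of_mem_parabolicBoundary {z : ℝ × ℝ} (hz : z ∈ parabolicBoundary) :
    z ∈ closedBoundary := by
  rcases hz with ⟨h1, h2⟩ | ⟨h1, h2⟩
  · rw [mem_singleton_iff] at h1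
    exact ⟨mem_closure_Q.2 ⟨by rw [h1]; simp, h2.1.le, h2.2.le⟩, Or.inl h1⟩
  · have h3 : z.2 = 0 ∨ z.2 = 1 := h2
    refine ⟨mem_closure_Q.2 ⟨⟨h1.1.le, h1.2.le⟩, ?_⟩, Or.inr h3⟩
    rcases h3 with h3 | h3 <;> rw [h3] <;> simp

theorem isCompact_closedBoundary : IsCompact closedBoundary := by
  refine isCompact_closure_Q.inter_right ?_
  exact (isClosed_eq continuous_fst continuous_const).union
    ((isClosed_eq continuous_snd continuous_const).union
      (isClosed_eq continuous_snd continuous_const))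

theorem eq_or_lt_of_mem_backwardCone {Λ : ℝ} (hΛ : 0 < Λ) {z ζ : ℝ × ℝ}
    (hζ : ζ ∈ backwardCone Λ z) : ζ = z ∨ ζ.1 < z.1 := by
  have h1 := hζ.2
  have h2 := (abs_nonneg _).trans h1
  rcases lt_or_ge ζ.1 z.1 with h3 | h3
  · exact Or.inr h3
  · have h4 : z.1 - ζ.1 = 0 := by
      have := nonneg_of_mul_nonneg_right h2 hΛ
      linarith
    rw [h4, mul_zero] at h1
    have h5 := abs_nonpos_iff.1 h1
    exact Or.inl (Prod.ext (by linarith) (by linarith))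

theorem self_mem_backwardCone (Λ : ℝ) {z : ℝ × ℝ} (hz : z ∈ closedBoundary) :
    z ∈ backwardCone Λ z := ⟨hz, by simp⟩

/-- This relies on `0 / 0 = 0`: on the closed boundary, staying put is a competitor of cost `h z`.
-/
theorem action_self (h : ℝ × ℝ → ℝ) (z : ℝ × ℝ) : action h z z = h z := by simp [action]

theorem notMem_closedBoundary {z : ℝ × ℝ} (hz : z ∈ Q) : z ∉ closedBoundary := by
  rintro ⟨-, h | h | h⟩ <;> have := mem_Q.1 hz <;> linarith [this.1.1, this.2.1, this.2.2]

/-- Joint convexity of `x²/t`: one straight line is no dearer than two concatenated ones. -/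
theorem add_sq_div_le {a b S T : ℝ} (hS : 0 < S) (hT : 0 < T) :
    (a + b) ^ 2 / (2 * (S + T)) ≤ a ^ 2 / (2 * S) + b ^ 2 / (2 * T) := by
  rw [div_add_div _ _ (by positivity) (by positivity), div_le_div_iff₀ (by positivity)
    (by positivity)]
  nlinarith [sq_nonneg (a * T - b * S)]

/-- Moving the endpoint by `D` changes the cost of a line of bounded speed by `O(L² D)`, because a
duration above `2 D` is at most halved. The constant 49 is not sharp. -/
theorem sq_div_le_sq_div_add {L D T X e f : ℝ} (hL : 1 ≤ L) (hD : 0 ≤ D) (hT : 2 * D < T)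
    (he : |e| ≤ D) (hf : |f| ≤ D) (hX : |X| ≤ 4 * L * T) :
    (X + e) ^ 2 / (2 * (T + f)) ≤ X ^ 2 / (2 * T) + 49 * L ^ 2 * D := by
  have hT0 : 0 < T := by linarith
  have hf' := abs_le.1 hf
  have hTf : 0 < T + f := by linarith [hf'.1]
  obtain ⟨p, rfl⟩ : ∃ p, X = p * T := ⟨X / T, by field_simp⟩
  have hp : |p| ≤ 4 * L := by
    rw [abs_mul, abs_of_pos hT0] at hX
    exact le_of_mul_le_mul_right hX hT0
  have hLL : L ≤ L ^ 2 := by nlinarith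
  have hp2 : p ^ 2 ≤ 16 * L ^ 2 := by
    have := sq_le_sq' (abs_le.1 hp).1 (abs_le.1 hp).2
    linarith
  have hDT : 0 ≤ D * T := by positivity
  have h1 : p * e ≤ 4 * L ^ 2 * D := by
    calc p * e ≤ |p| * |e| := by rw [← abs_mul]; exact le_abs_self _
      _ ≤ 4 * L * D := mul_le_mul hp he (abs_nonneg _) (by linarith)
      _ ≤ 4 * L ^ 2 * D := by nlinarith
  have h2 : e ^ 2 ≤ D * T := by
    have := sq_le_sq' (abs_le.1 he).1 (abs_le.1 he).2
    nlinarith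
  have h3 : -(p ^ 2 * f) ≤ 16 * L ^ 2 * D := by
    calc -(p ^ 2 * f) ≤ p ^ 2 * D := by nlinarith [sq_nonneg p, hf'.1]
      _ ≤ 16 * L ^ 2 * D := mul_le_mul_of_nonneg_right hp2 hD
  have e0 : (p * T) ^ 2 / (2 * T) = p ^ 2 * T / 2 := by field_simp
  rw [e0, div_le_iff₀ (by positivity)]
  have h4 : 49 * L ^ 2 * D * T ≤ 49 * L ^ 2 * D * (2 * (T + f)) :=
    mul_le_mul_of_nonneg_left (by linarith [hf'.1]) (by positivity)
  have h5 := mul_le_mul_of_nonneg_right h1 hT0.le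
  have h6 := mul_le_mul_of_nonneg_right h3 hT0.le
  have h7 : 1 * (D * T) ≤ L ^ 2 * (D * T) := mul_le_mul_of_nonneg_right (by linarith) hDT
  nlinarith

variable {L : ℝ} {h : ℝ × ℝ → ℝ}

theorem le_action_of_mem_backwardCone (hL : 0 < L) (hh : EuclideanLipschitzOn L h (closure Q))
    (hs : SolvesHJAE Q h) {Λ : ℝ} (hΛ : 0 < Λ) {z ζ : ℝ × ℝ} (hz : z ∈ closure Q)
    (hζ : ζ ∈ backwardCone Λ z) : h z ≤ action h z ζ := by
  rcases eq_or_lt_of_mem_backwardCone hΛ hζ with h1 | h1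
  · rw [h1, action_self]
  · exact hs.le_action hL.le hh hζ.1.1 hz h1

theorem exists_isLeast_action (hL : 0 < L) (hh : EuclideanLipschitzOn L h (closure Q))
    (hs : SolvesHJAE Q h) {Λ : ℝ} (hΛ : 0 < Λ) {z : ℝ × ℝ} (hz : z ∈ closure Q) :
    ∃ ζ ∈ backwardCone Λ z, ∀ ζ' ∈ backwardCone Λ z, action h z ζ ≤ action h z ζ' := by
  by_cases hzΓ : z ∈ closedBoundary
  · exact ⟨z, self_mem_backwardCone Λ hzΓ, fun ζ' hζ' => by
      rw [action_self]; exact le_action_of_mem_backwardCone hL hh hs hΛ hz hζ'⟩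
  · obtain ⟨⟨a1, a2⟩, a3, a4⟩ := mem_closure_Q.1 hz
    have hcl : IsClosed {ζ : ℝ × ℝ | |z.2 - ζ.2| ≤ Λ * (z.1 - ζ.1)} :=
      isClosed_le (by fun_prop) (by fun_prop)
    have hne : (backwardCone Λ z).Nonempty := by
      refine ⟨(0, z.2), ⟨mem_closure_Q.2 ⟨by simp, a3, a4⟩, Or.inl rfl⟩, ?_⟩
      simp only [sub_self, abs_zero, sub_zero]; positivity
    -- The speed bound excludes start points at the same time as `z`, other than `z` itself, so the
    -- denominator does not vanish.
    have hcont : ContinuousOn (action h z) (backwardCone Λ z) := by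
      have h1 : ContinuousOn h (closure Q) := (hh.lipschitzOnWith hL.le).continuousOn
      refine (h1.mono fun ζ hζ => hζ.1.1).add (ContinuousOn.div (by fun_prop) (by fun_prop) ?_)
      intro ζ hζ
      rcases eq_or_lt_of_mem_backwardCone hΛ hζ with h2 | h2
      · exact absurd (h2 ▸ hζ.1) hzΓ
      · have := sub_pos.2 h2; positivity
    exact (isCompact_closedBoundary.inter_right hcl).exists_isMinOn hne hcont

theorem exists_hopfLax_eq (hL : 0 < L) (hh : EuclideanLipschitzOn L h (closure Q))
    (hs : SolvesHJAE Q h) {Λ : ℝ} (hΛ : 0 < Λ) {z : ℝ × ℝ} (hz : z ∈ closure Q) :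
    ∃ ζ ∈ backwardCone Λ z, hopfLax h Λ z = action h z ζ ∧
      ∀ ζ' ∈ backwardCone Λ z, hopfLax h Λ z ≤ action h z ζ' := by
  obtain ⟨ζ, hζ, hmin⟩ := exists_isLeast_action hL hh hs hΛ hz
  have h1 : hopfLax h Λ z = action h z ζ :=
    IsLeast.csInf_eq ⟨mem_image_of_mem _ hζ, by rintro _ ⟨ζ', hζ', rfl⟩; exact hmin ζ' hζ'⟩
  exact ⟨ζ, hζ, h1, fun ζ' hζ' => h1 ▸ hmin ζ' hζ'⟩

theorem le_hopfLax (hL : 0 < L) (hh : EuclideanLipschitzOn L h (closure Q))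
    (hs : SolvesHJAE Q h) {Λ : ℝ} (hΛ : 0 < Λ) {z : ℝ × ℝ} (hz : z ∈ closure Q) :
    h z ≤ hopfLax h Λ z := by
  obtain ⟨ζ, hζ, h1, -⟩ := exists_hopfLax_eq hL hh hs hΛ hz
  rw [h1]; exact le_action_of_mem_backwardCone hL hh hs hΛ hz hζ

theorem hopfLax_eq_of_mem_closedBoundary (hL : 0 < L)
    (hh : EuclideanLipschitzOn L h (closure Q)) (hs : SolvesHJAE Q h) {Λ : ℝ} (hΛ : 0 < Λ)
    {z : ℝ × ℝ} (hz : z ∈ closedBoundary) : hopfLax h Λ z = h z := by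
  obtain ⟨ζ, -, -, h1⟩ := exists_hopfLax_eq hL hh hs hΛ hz.1
  refine le_antisymm ?_ (le_hopfLax hL hh hs hΛ hz.1)
  simpa only [action_self] using h1 z (self_mem_backwardCone Λ hz)

/-- Speeds larger than four times the Lipschitz constant are never favourable. -/
theorem exists_mem_backwardCone_action_le (hL : 1 ≤ L)
    (hh : EuclideanLipschitzOn L h (closure Q)) {z ζ : ℝ × ℝ} (hz : z ∈ closure Q)
    (hζ : ζ ∈ closedBoundary) (hlt : ζ.1 < z.1) :
    ∃ ζ' ∈ backwardCone (4 * L) z, action h z ζ' ≤ action h z ζ := by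
  have hL0 : 0 ≤ L := by linarith
  by_cases hcone : |z.2 - ζ.2| ≤ 4 * L * (z.1 - ζ.1)
  · exact ⟨ζ, ⟨hζ, hcone⟩, le_rfl⟩
  rw [not_le] at hcone
  obtain ⟨⟨a1, a2⟩, a3, a4⟩ := mem_closure_Q.1 hz
  obtain ⟨⟨b1, b2⟩, b3, b4⟩ := mem_closure_Q.1 hζ.1
  set X := |z.2 - ζ.2| with hX
  set T := z.1 - ζ.1 with hT
  have hT0 : 0 < T := sub_pos.2 hlt
  have hX0 : 0 < X := lt_of_le_of_lt (by positivity) hcone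
  have hsq : (z.2 - ζ.2) ^ 2 = X ^ 2 := (sq_abs _).symm
  -- If even a start at time 0 would be too fast, the competitor is rest at `z.2`: the fast line
  -- costs at least `2 L X`, which outweighs the change of `h` between the start points.
  have hbase : 4 * L * z.1 ≤ X →
      ∃ ζ' ∈ backwardCone (4 * L) z, action h z ζ' ≤ action h z ζ := by
    intro hXz
    have hmem : ((0 : ℝ), z.2) ∈ closure Q := mem_closure_Q.2 ⟨by simp, a3, a4⟩
    refine ⟨(0, z.2), ⟨⟨hmem, Or.inl rfl⟩, ?_⟩, ?_⟩
    · simp only [sub_self, abs_zero, sub_zero]; positivity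
    · have h1 := hh.le_add hL0 hmem hζ.1
      simp only [zero_sub, abs_neg, abs_of_nonneg b1] at h1
      have h2 : 2 * L * X ≤ X ^ 2 / (2 * T) := by
        rw [le_div_iff₀ (by positivity)]; nlinarith
      have h3 : ζ.1 ≤ X := by nlinarith
      simp only [action, sub_self, ← hT, hsq]
      rw [← hX] at h1
      norm_num
      nlinarith
  rcases hζ.2 with h0 | hlat
  · refine hbase ?_
    rw [hT, h0, sub_zero] at hcone; exact hcone.le
  · rcases le_or_gt X (4 * L * z.1) with h1 | h1
    · set s := z.1 - X / (4 * L) with hs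
      have hs0 : 0 ≤ s := by
        rw [hs, sub_nonneg, div_le_iff₀ (by positivity)]; linarith
      have hsT : X / (4 * L) - T = ζ.1 - s := by rw [hs, hT]; ring
      have hTX : T < X / (4 * L) := by rw [lt_div_iff₀ (by positivity)]; linarith
      have hmem : (s, ζ.2) ∈ closure Q := mem_closure_Q.2 ⟨⟨hs0, by linarith⟩, b3, b4⟩
      refine ⟨(s, ζ.2), ⟨⟨hmem, Or.inr hlat⟩, ?_⟩, ?_⟩
      · change X ≤ 4 * L * (z.1 - s)
        rw [hs, sub_sub_cancel, mul_div_cancel₀ _ (by positivity)]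
      · have h2 := hh.le_add hL0 hmem hζ.1
        simp only [sub_self, abs_zero, add_zero] at h2
        rw [abs_sub_comm, ← hsT, abs_of_pos (by linarith)] at h2
        simp only [action, ← hT, hsq]
        have h3 : z.1 - s = X / (4 * L) := by rw [hs]; ring
        have h4 : X ^ 2 / (2 * (X / (4 * L))) = 2 * L * X := by field_simp; norm_num
        rw [h3, h4]
        have h5 : L * (X / (4 * L)) = X / 4 := by field_simp
        have h6 : X / 4 - L * T + 2 * L * X ≤ X ^ 2 / (2 * T) := by
          rw [le_div_iff₀ (by positivity)]
          have : 0 ≤ (X - 4 * L * T) * (X - T / 2) := by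
            refine mul_nonneg (by linarith) ?_
            nlinarith
          nlinarith
        nlinarith
    · exact hbase h1.le

theorem hopfLax_le_action (hL : 1 ≤ L) (hh : EuclideanLipschitzOn L h (closure Q))
    (hs : SolvesHJAE Q h) {z ζ : ℝ × ℝ} (hz : z ∈ closure Q) (hζ : ζ ∈ closedBoundary)
    (hlt : ζ.1 < z.1) : hopfLax h (4 * L) z ≤ action h z ζ := by
  obtain ⟨ζ', hζ', h1⟩ := exists_mem_backwardCone_action_le hL hh hz hζ hlt
  obtain ⟨-, -, -, h2⟩ := exists_hopfLax_eq (by linarith) hh hs (Λ := 4 * L) (by linarith) hz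
  exact (h2 ζ' hζ').trans h1

/-- The dynamic programming inequality. -/
theorem hopfLax_le_add (hL : 1 ≤ L) (hh : EuclideanLipschitzOn L h (closure Q))
    (hs : SolvesHJAE Q h) {z z' : ℝ × ℝ} (hz : z ∈ closure Q) (hz' : z' ∈ closure Q)
    (hlt : z.1 < z'.1) :
    hopfLax h (4 * L) z' ≤ hopfLax h (4 * L) z + (z'.2 - z.2) ^ 2 / (2 * (z'.1 - z.1)) := by
  have hΛ : 0 < 4 * L := by linarith
  obtain ⟨ζ, hζ, h1, -⟩ := exists_hopfLax_eq (by linarith) hh hs hΛ hz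
  rw [h1]
  rcases eq_or_lt_of_mem_backwardCone hΛ hζ with h2 | h2
  · rw [h2, action_self]
    exact hopfLax_le_action hL hh hs hz' (h2 ▸ hζ.1) hlt
  · refine (hopfLax_le_action hL hh hs hz' hζ.1 (h2.trans hlt)).trans ?_
    -- The optimal line into `z` followed by the line to `z'` is replaced by one straight line from
    -- `ζ`.
    have := add_sq_div_le (a := z'.2 - z.2) (b := z.2 - ζ.2) (sub_pos.2 hlt) (sub_pos.2 h2)
    simp only [sub_add_sub_cancel] at this
    unfold action
    linarith

/-- The Hopf–Lax solution approaches the data at a linear rate near the parabolic boundary. -/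
theorem hopfLax_le_of_mem_closedBoundary (hL : 1 ≤ L)
    (hh : EuclideanLipschitzOn L h (closure Q)) (hs : SolvesHJAE Q h) {z ζ : ℝ × ℝ}
    (hz : z ∈ closure Q) (hζ : ζ ∈ closedBoundary) :
    hopfLax h (4 * L) z ≤ h z + 3 * L * (|z.1 - ζ.1| + |z.2 - ζ.2|) := by
  have hΛ : 0 < 4 * L := by linarith
  have hL0 : 0 ≤ L := by linarith
  obtain ⟨⟨a1, a2⟩, a3, a4⟩ := mem_closure_Q.1 hz
  obtain ⟨⟨b1, b2⟩, b3, b4⟩ := mem_closure_Q.1 hζ.1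
  have hp1 := abs_nonneg (z.1 - ζ.1)
  have hp2 := abs_nonneg (z.2 - ζ.2)
  by_cases hzΓ : z ∈ closedBoundary
  · rw [hopfLax_eq_of_mem_closedBoundary (by linarith) hh hs hΛ hzΓ]
    have : 0 ≤ 3 * L * (|z.1 - ζ.1| + |z.2 - ζ.2|) := by positivity
    linarith
  have hz0 : 0 < z.1 := lt_of_le_of_ne a1 fun h0 => hzΓ ⟨hz, Or.inl h0.symm⟩
  have hbase : hopfLax h (4 * L) z ≤ h z + L * z.1 := by
    have hmem : ((0 : ℝ), z.2) ∈ closure Q := mem_closure_Q.2 ⟨by simp, a3, a4⟩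
    have h1 := hopfLax_le_action hL hh hs hz (ζ := (0, z.2)) ⟨hmem, Or.inl rfl⟩ hz0
    have h2 := hh.le_add hL0 hmem hz
    simp only [action, sub_self, zero_sub, abs_neg, abs_of_nonneg a1, abs_zero] at h1 h2
    norm_num at h1
    linarith
  rcases hζ.2 with h0 | hlat
  · rw [h0, sub_zero, abs_of_nonneg a1]
    nlinarith
  · set d := |z.2 - ζ.2| with hd
    have hd0 : 0 < d := lt_of_le_of_ne hp2 fun h0 => hzΓ ⟨hz, Or.inr (by
      have := abs_eq_zero.1 (hd ▸ h0.symm); rwa [sub_eq_zero.1 this])⟩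
    have hsq : (z.2 - ζ.2) ^ 2 = d ^ 2 := (sq_abs _).symm
    rcases lt_or_ge z.1 d with h1 | h1
    · nlinarith
    -- The competitor leaves the lateral side at unit speed: it costs `d/2`, and `h` varies by at
    -- most `2 L d`.
    · have hmem : (z.1 - d, ζ.2) ∈ closure Q :=
        mem_closure_Q.2 ⟨⟨by simpa using h1, by simp only; linarith⟩, b3, b4⟩
      have h2 := hopfLax_le_action hL hh hs hz (ζ := (z.1 - d, ζ.2)) ⟨hmem, Or.inr hlat⟩
        (by simp only; linarith)
      have h3 := hh.le_add hL0 hmem hz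
      have e1 : z.1 - d - z.1 = -d := by ring
      have e2 : z.1 - (z.1 - d) = d := by ring
      have e3 : d ^ 2 / (2 * d) = d / 2 := by field_simp
      simp only [action, hsq, e2, e3] at h2
      simp only [e1, abs_neg, abs_of_pos hd0] at h3
      rw [abs_sub_comm, ← hd] at h3
      nlinarith

theorem hopfLax_le_add_l1 (hL : 1 ≤ L) (hh : EuclideanLipschitzOn L h (closure Q))
    (hs : SolvesHJAE Q h) {z z' : ℝ × ℝ} (hz : z ∈ closure Q) (hz' : z' ∈ closure Q) :
    hopfLax h (4 * L) z' ≤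
      hopfLax h (4 * L) z + 49 * L ^ 2 * (|z'.1 - z.1| + |z'.2 - z.2|) := by
  have hΛ : 0 < 4 * L := by linarith
  have hL0 : 0 < L := by linarith
  obtain ⟨ζ, hζ, h1, -⟩ := exists_hopfLax_eq hL0 hh hs hΛ hz
  have hp1 := abs_nonneg (z'.1 - z.1)
  have hp2 := abs_nonneg (z'.2 - z.2)
  set D := |z'.1 - z.1| + |z'.2 - z.2| with hD
  set T := z.1 - ζ.1 with hT
  have hcone := hζ.2
  rw [← hT] at hcone
  have hT0 : 0 ≤ T := nonneg_of_mul_nonneg_right ((abs_nonneg _).trans hcone) hΛ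
  have d1 := abs_le.1 (show |z'.1 - z.1| ≤ D by linarith)
  have d2 := abs_le.1 (show |z'.2 - z.2| ≤ D by linarith)
  have hLL : L ≤ L ^ 2 := by nlinarith
  have hD0 : 0 ≤ D := by positivity
  -- If the optimal line is long compared with `D`, its start `ζ` also serves `z'`. Otherwise both
  -- points are within `O(L D)` of the boundary point `ζ`, where the Hopf–Lax function is close to
  -- `h`.
  rcases lt_or_ge (2 * D) T with h2 | h2
  · have hT' : T / 2 ≤ z'.1 - ζ.1 := by linarith [d1.1]
    have hT'0 : 0 < z'.1 - ζ.1 := by linarith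
    refine (hopfLax_le_action hL hh hs hz' hζ.1 (by linarith)).trans ?_
    rw [h1]
    unfold action
    rw [← hT]
    have hTp : 0 < T := by linarith
    have key := sq_div_le_sq_div_add hL hD0 h2 (X := z.2 - ζ.2) (e := z'.2 - z.2)
      (f := z'.1 - z.1) (by linarith) (by linarith) hcone
    rw [show z.2 - ζ.2 + (z'.2 - z.2) = z'.2 - ζ.2 by ring,
      show T + (z'.1 - z.1) = z'.1 - ζ.1 by rw [hT]; ring] at key
    linarith
  · refine (hopfLax_le_of_mem_closedBoundary hL hh hs hz' hζ.1).trans ?_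
    have h3 := hh.le_add hL0.le hz' hz
    have h4 := le_hopfLax hL0 hh hs hΛ hz
    have h5 : |z'.1 - ζ.1| ≤ D + T := by
      have : z'.1 - ζ.1 = (z'.1 - z.1) + T := by rw [hT]; ring
      rw [this]; refine (abs_add_le _ _).trans ?_
      rw [abs_of_nonneg hT0]; linarith
    have h6 : |z'.2 - ζ.2| ≤ D + 4 * L * T := by
      have : z'.2 - ζ.2 = (z'.2 - z.2) + (z.2 - ζ.2) := by ring
      rw [this]; refine (abs_add_le _ _).trans ?_
      linarith
    have h7 : 3 * L * (|z'.1 - ζ.1| + |z'.2 - ζ.2|) ≤ 3 * L * (4 * D + 8 * L * D) := by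
      refine mul_le_mul_of_nonneg_left ?_ (by positivity)
      nlinarith
    rw [← hD] at h3
    nlinarith [mul_le_mul_of_nonneg_right hLL hD0]

theorem continuousOn_hopfLax (hL : 1 ≤ L) (hh : EuclideanLipschitzOn L h (closure Q))
    (hs : SolvesHJAE Q h) : ContinuousOn (hopfLax h (4 * L)) (closure Q) := by
  refine (LipschitzOnWith.of_le_add_mul (K := (2 * (49 * L ^ 2)).toNNReal) fun z hz w hw => ?_).continuousOn
  refine (hopfLax_le_add_l1 hL hh hs hw hz).trans ?_
  rw [Real.coe_toNNReal _ (by positivity)]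
  have h1 : |z.1 - w.1| ≤ dist z w := by rw [← Real.dist_eq]; exact le_max_left _ _
  have h2 : |z.2 - w.2| ≤ dist z w := by rw [← Real.dist_eq]; exact le_max_right _ _
  nlinarith [sq_nonneg L]

open Filter Topology in
theorem tendsto_backward_difference {φ : ℝ × ℝ → ℝ} {z v : ℝ × ℝ} (hφ : DifferentiableAt ℝ φ z) :
    Tendsto (fun τ : ℝ => τ⁻¹ * (φ z - φ (z - τ • v))) (𝓝[>] 0) (𝓝 (fderiv ℝ φ z v)) := by
  have h1 : HasDerivAt (fun τ : ℝ => z - τ • v) (-v) 0 := by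
    simpa using ((hasDerivAt_id (0 : ℝ)).smul_const v).const_sub z
  have h2 : HasFDerivAt φ (fderiv ℝ φ z) (z - (0 : ℝ) • v) := by simpa using hφ.hasFDerivAt
  have h3 := (h2.comp_hasDerivAt (0 : ℝ) h1).tendsto_slope_zero_right.neg
  simp only [map_neg, neg_neg, Function.comp_apply, zero_add, zero_smul, sub_zero, smul_eq_mul] at h3
  exact h3.congr fun τ => by ring

open Filter Topology in
theorem eventually_sub_smul_mem_Q {z : ℝ × ℝ} (hz : z ∈ Q) (v : ℝ × ℝ) {P : ℝ × ℝ → Prop}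
    (hP : ∀ᶠ w in 𝓝 z, P w) :
    ∀ᶠ τ : ℝ in 𝓝[>] 0, 0 < τ ∧ z - τ • v ∈ Q ∧ P (z - τ • v) := by
  have h1 : Tendsto (fun τ : ℝ => z - τ • v) (𝓝[>] 0) (𝓝 z) := by
    have : Continuous fun τ : ℝ => z - τ • v := by fun_prop
    have := (this.tendsto 0).mono_left (nhdsWithin_le_nhds (s := Ioi 0))
    simpa using this
  filter_upwards [self_mem_nhdsWithin, h1.eventually (isOpen_Q.mem_nhds hz), h1.eventually hP]
    with τ a b c using ⟨a, b, c⟩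

/-- Dynamic programming along the backward line of speed `p = ∂ₓφ`, the speed that is optimal in the
Legendre transform, gives `∂ₜφ + p² ≤ p²/2`. -/
theorem isViscositySubsolution_hopfLax (hL : 1 ≤ L) (hh : EuclideanLipschitzOn L h (closure Q))
    (hs : SolvesHJAE Q h) : IsViscositySubsolution Q (hopfLax h (4 * L)) := by
  refine ⟨(continuousOn_hopfLax hL hh hs).mono subset_closure, fun z hz φ hφ hmax => ?_⟩
  set p := dx φ z with hp
  have h1 := tendsto_backward_difference (v := (1, p)) (hφ.differentiableAt one_ne_zero)
  have h2 : fderiv ℝ φ z (1, p) ≤ p ^ 2 / 2 := by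
    refine le_of_tendsto h1 ?_
    filter_upwards [eventually_sub_smul_mem_Q hz (1, p) hmax] with τ ⟨hτ, hτQ, hτm⟩
    have h3 := hopfLax_le_add hL hh hs (subset_closure hτQ) (subset_closure hz) (by
      simpa using hτ)
    simp only [Prod.snd_sub, Prod.smul_snd, smul_eq_mul, Prod.fst_sub, Prod.smul_fst, mul_one,
      sub_sub_cancel] at h3 hτm
    have h4 : (τ * p) ^ 2 / (2 * τ) = τ * (p ^ 2 / 2) := by field_simp
    rw [inv_mul_le_iff₀ hτ]
    linarith
  rw [fderiv_apply_eq, ← hp] at h2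
  simp only [one_mul] at h2
  linarith

/-- Going back along the optimal line, of speed `p`, the value drops at rate at least `p²/2`, since
its start still competes. Hence `∂ₜφ + p ∂ₓφ ≥ p²/2`, and Young's inequality concludes. -/
theorem isViscositySupersolution_hopfLax (hL : 1 ≤ L)
    (hh : EuclideanLipschitzOn L h (closure Q))
    (hs : SolvesHJAE Q h) : IsViscositySupersolution Q (hopfLax h (4 * L)) := by
  refine ⟨(continuousOn_hopfLax hL hh hs).mono subset_closure, fun z hz φ hφ hmin => ?_⟩
  have hΛ : 0 < 4 * L := by linarith
  obtain ⟨ζ, hζ, h1, -⟩ := exists_hopfLax_eq (by linarith) hh hs hΛ (subset_closure hz)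
  rcases eq_or_lt_of_mem_backwardCone hΛ hζ with h2 | h2
  · exact absurd (h2 ▸ hζ.1) (notMem_closedBoundary hz)
  set T := z.1 - ζ.1 with hT
  have hT0 : 0 < T := sub_pos.2 h2
  set p := (z.2 - ζ.2) / T with hp
  have hpT : z.2 - ζ.2 = p * T := by rw [hp]; field_simp
  have h3 := tendsto_backward_difference (v := (1, p)) (hφ.differentiableAt one_ne_zero)
  have h4 : p ^ 2 / 2 ≤ fderiv ℝ φ z (1, p) := by
    refine ge_of_tendsto h3 ?_
    filter_upwards [eventually_sub_smul_mem_Q hz (1, p) hmin,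
      (eventually_lt_nhds hT0).filter_mono nhdsWithin_le_nhds] with τ ⟨hτ, hτQ, hτm⟩ hτT
    have h5 := hopfLax_le_action hL hh hs (subset_closure hτQ) hζ.1 (by
      simp only [Prod.fst_sub, Prod.smul_fst, smul_eq_mul, mul_one]; linarith)
    simp only [action, Prod.snd_sub, Prod.smul_snd, smul_eq_mul, Prod.fst_sub, Prod.smul_fst,
      mul_one] at h5
    have e1 : z.2 - τ * p - ζ.2 = p * (T - τ) := by linarith
    have e2 : z.1 - τ - ζ.1 = T - τ := by rw [hT]; ring
    have e3 : (p * (T - τ)) ^ 2 / (2 * (T - τ)) = p ^ 2 / 2 * (T - τ) := by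
      have : T - τ ≠ 0 := by linarith
      field_simp
    have e4 : (p * T) ^ 2 / (2 * T) = p ^ 2 / 2 * T := by field_simp
    rw [e1, e2, e3] at h5
    rw [action, ← hT, hpT, e4] at h1
    rw [le_inv_mul_iff₀ hτ]
    linarith
  rw [fderiv_apply_eq] at h4
  simp only [one_mul] at h4
  nlinarith [sq_nonneg (p - dx φ z)]

theorem isViscositySolutionWithData_hopfLax (hL : 1 ≤ L)
    (hh : EuclideanLipschitzOn L h (closure Q)) (hs : SolvesHJAE Q h) :
    IsViscositySolutionWithData h (hopfLax h (4 * L)) where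
  continuousOn := continuousOn_hopfLax hL hh hs
  sub := isViscositySubsolution_hopfLax hL hh hs
  super := isViscositySupersolution_hopfLax hL hh hs
  boundary z hz := hopfLax_eq_of_mem_closedBoundary (by linarith) hh hs (by linarith)
    (mem_closedBoundary_of_mem_parabolicBoundary hz)

end BurgersHJ

/-! ### Doubling of variables, comparison and uniqueness. -/

namespace BurgersHJ

theorem hasFDerivAt_add_separate {a b : ℝ → ℝ} {a' b' : ℝ} {z : ℝ × ℝ}
    (ha : HasDerivAt a a' z.1) (hb : HasDerivAt b b' z.2) :
    HasFDerivAt (fun w : ℝ × ℝ => a w.1 + b w.2)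
      (a' • ContinuousLinearMap.fst ℝ ℝ ℝ + b' • ContinuousLinearMap.snd ℝ ℝ ℝ) z :=
  (ha.comp_hasFDerivAt z hasFDerivAt_fst).add (hb.comp_hasFDerivAt z hasFDerivAt_snd)

theorem dt_add_separate {a b : ℝ → ℝ} {a' b' : ℝ} {z : ℝ × ℝ}
    (ha : HasDerivAt a a' z.1) (hb : HasDerivAt b b' z.2) :
    dt (fun w : ℝ × ℝ => a w.1 + b w.2) z = a' := by
  simp [dt, (hasFDerivAt_add_separate ha hb).fderiv]

theorem dx_add_separate {a b : ℝ → ℝ} {a' b' : ℝ} {z : ℝ × ℝ}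
    (ha : HasDerivAt a a' z.1) (hb : HasDerivAt b b' z.2) :
    dx (fun w : ℝ × ℝ => a w.1 + b w.2) z = b' := by
  simp [dx, (hasFDerivAt_add_separate ha hb).fderiv]

theorem hasDerivAt_sq_div (c ε x : ℝ) :
    HasDerivAt (fun s : ℝ => (c - s) ^ 2 / (2 * ε)) ((x - c) / ε) x := by
  have h1 := (((hasDerivAt_id x).const_sub c).pow 2).div_const (2 * ε)
  refine h1.congr_deriv ?_
  simp only [id, Nat.cast_ofNat, Nat.add_one_sub_one, pow_one]
  rw [show 2 * (c - x) * -1 = 2 * (x - c) by ring, mul_div_mul_left _ _ two_ne_zero]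

theorem hasDerivAt_div_one_sub (c : ℝ) {x : ℝ} (hx : x < 1) :
    HasDerivAt (fun s : ℝ => c / (1 - s)) (c / (1 - x) ^ 2) x := by
  have h0 : (1 : ℝ) - x ≠ 0 := by linarith
  have h1 := (hasDerivAt_const x c).div ((hasDerivAt_id x).const_sub 1) h0
  refine h1.congr_deriv ?_
  simp

/-- Doubling of variables: where a subsolution `v` exceeds `g`, some paraboloid touches `g` from
below with a slope that violates the equation. -/
theorem exists_touching_paraboloid {v g : ℝ × ℝ → ℝ} {m ε ρ B t₁ : ℝ} {z₁ : ℝ × ℝ}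
    (hv : ContinuousOn v (closure Q)) (hg : ContinuousOn g (closure Q))
    (hsub : IsViscositySubsolution Q v) (hm : 0 < m) (hρ : 0 < ρ) (ht₁ : t₁ < 1)
    (hz₁ : z₁ ∈ Q) (hz₁t : z₁.1 ≤ t₁) (hgap : m ≤ v z₁ - g z₁)
    (hclose : ∀ z ∈ closure Q, ∀ w ∈ closure Q,
      ((z.1 - w.1) ^ 2 + (z.2 - w.2) ^ 2) / (2 * ε) ≤ g w - g z →
        |z.1 - w.1| ≤ ρ ∧ |z.2 - w.2| ≤ ρ ∧ g w - g z ≤ m / 8)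
    (hbdry : ∀ w ∈ closure Q, w.1 ≤ 2 * ρ ∨ w.2 ≤ 2 * ρ ∨ 1 - 2 * ρ ≤ w.2 → v w - g w ≤ m / 4)
    (hB : ∀ w ∈ closure Q, v w - g w ≤ B) (hρB : 2 * ρ * B ≤ m * (1 - t₁) / 2) (hε : 0 < ε) :
    ∃ z₀ p : ℝ × ℝ, (ρ < z₀.1 ∧ z₀.1 < 1 - ρ) ∧ (ρ < z₀.2 ∧ z₀.2 < 1 - ρ) ∧
      z₀ + ε • p ∈ closure Q ∧
      ε * (p.1 ^ 2 + p.2 ^ 2) / 2 ≤ g (z₀ + ε • p) - g z₀ ∧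
      p.1 + p.2 ^ 2 / 2 ≤ -(m * (1 - t₁) / 2) ∧
      ∀ z ∈ closure Q, g z₀ + (p.1 * (z.1 - z₀.1) + p.2 * (z.2 - z₀.2)) -
        ((z.1 - z₀.1) ^ 2 + (z.2 - z₀.2) ^ 2) / (2 * ε) ≤ g z := by
  -- The penalty `lam / (1 - t)` costs at most `m/2` at `z₁`, and its derivative, at least `lam`,
  -- creates the strict defect.
  set lam := m * (1 - t₁) / 2 with hlam
  have hθ : 0 < 1 - t₁ := sub_pos.2 ht₁
  have hlam0 : 0 < lam := by positivity
  have hz₁c := subset_closure hz₁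
  have hmB : m ≤ B := hgap.trans (hB z₁ hz₁c)
  have hρθ : 2 * ρ < 1 - t₁ := by
    have : 2 * ρ * m ≤ m * (1 - t₁) / 2 := (mul_le_mul_of_nonneg_left hmB (by positivity)).trans hρB
    by_contra! hcon
    nlinarith [mul_le_mul_of_nonneg_left hcon hm.le, mul_pos hm hθ]
  -- The cut at time `1 - 2ρ` keeps the penalty continuous on a compact set.
  set D : Set (ℝ × ℝ) := closure Q ∩ {w | w.1 ≤ 1 - 2 * ρ} with hD
  have hDc : IsCompact D := isCompact_closure_Q.inter_right (isClosed_le (by fun_prop) (by fun_prop))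
  have hz₁D : z₁ ∈ D := ⟨hz₁c, by change z₁.1 ≤ _; linarith⟩
  set Φ : (ℝ × ℝ) × (ℝ × ℝ) → ℝ := fun q => v q.2 - g q.1 -
    ((q.1.1 - q.2.1) ^ 2 + (q.1.2 - q.2.2) ^ 2) / (2 * ε) - lam / (1 - q.2.1) with hΦ
  have hΦc : ContinuousOn Φ (closure Q ×ˢ D) := by
    refine ContinuousOn.sub (ContinuousOn.sub (ContinuousOn.sub ?_ ?_) (by fun_prop)) ?_
    · exact hv.comp continuousOn_snd fun q hq => hq.2.1
    · exact hg.comp continuousOn_fst fun q hq => hq.1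
    · refine ContinuousOn.div (by fun_prop) (by fun_prop) fun q hq => ?_
      have : q.2.1 ≤ 1 - 2 * ρ := hq.2.2
      linarith
  obtain ⟨⟨z₀, w₀⟩, ⟨hz₀, hw₀⟩, hmax⟩ :=
    (isCompact_closure_Q.prod hDc).exists_isMaxOn ⟨(z₁, z₁), hz₁c, hz₁D⟩ hΦc
  have hmax' : ∀ z ∈ closure Q, ∀ w ∈ D, Φ (z, w) ≤ Φ (z₀, w₀) := fun z hz w hw =>
    hmax (mk_mem_prod hz hw)
  simp only [hΦ] at hmax'
  have hdist : ((z₀.1 - w₀.1) ^ 2 + (z₀.2 - w₀.2) ^ 2) / (2 * ε) ≤ g w₀ - g z₀ := by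
    have := hmax' w₀ hw₀.1 w₀ hw₀
    simp only [sub_self, ne_eq, OfNat.ofNat_ne_zero, not_false_eq_true, zero_pow, add_zero,
      zero_div, sub_zero] at this
    linarith
  obtain ⟨hd1, hd2, hgd⟩ := hclose z₀ hz₀ w₀ hw₀.1 hdist
  have hw₀t : w₀.1 ≤ 1 - 2 * ρ := hw₀.2
  have hpen0 : 0 < lam / (1 - w₀.1) := div_pos hlam0 (by linarith)
  have hval : m / 2 + lam / (1 - w₀.1) ≤ v w₀ - g z₀ := by
    have h1 := hmax' z₁ hz₁c z₁ hz₁D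
    simp only [sub_self, ne_eq, OfNat.ofNat_ne_zero, not_false_eq_true, zero_pow, add_zero,
      zero_div, sub_zero] at h1
    have h2 : lam / (1 - z₁.1) ≤ m / 2 := by
      rw [div_le_iff₀ (by linarith), hlam]; nlinarith
    have h3 : 0 ≤ ((z₀.1 - w₀.1) ^ 2 + (z₀.2 - w₀.2) ^ 2) / (2 * ε) := by positivity
    linarith
  have hvg : m / 4 + lam / (1 - w₀.1) < v w₀ - g w₀ := by linarith
  have hw1 : 2 * ρ < w₀.1 := by
    by_contra! hc; linarith [hbdry w₀ hw₀.1 (Or.inl hc)]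
  have hw2 : 2 * ρ < w₀.2 := by
    by_contra! hc; linarith [hbdry w₀ hw₀.1 (Or.inr (Or.inl hc))]
  have hw3 : w₀.2 < 1 - 2 * ρ := by
    by_contra! hc; linarith [hbdry w₀ hw₀.1 (Or.inr (Or.inr hc))]
  -- On the cut the penalty is `lam / (2ρ) ≥ B`, more than `v - g` can pay for.
  have hw4 : w₀.1 < 1 - 2 * ρ := by
    refine lt_of_le_of_ne hw₀t fun hc => ?_
    have h1 : B ≤ lam / (1 - w₀.1) := by
      rw [le_div_iff₀ (by linarith), hc]; linarith
    linarith [hB w₀ hw₀.1]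
  have hw₀Q : w₀ ∈ Q := mem_Q.2 ⟨⟨by linarith, by linarith⟩, by linarith, by linarith⟩
  have d1 := abs_le.1 hd1
  have d2 := abs_le.1 hd2
  obtain ⟨p, hp⟩ : ∃ p : ℝ × ℝ, p = ε⁻¹ • (w₀ - z₀) := ⟨_, rfl⟩
  have hp1 : ε * p.1 = w₀.1 - z₀.1 := by
    rw [hp]; simp only [Prod.smul_fst, Prod.fst_sub, smul_eq_mul]; field_simp
  have hp2 : ε * p.2 = w₀.2 - z₀.2 := by
    rw [hp]; simp only [Prod.smul_snd, Prod.snd_sub, smul_eq_mul]; field_simp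
  have hzp : z₀ + ε • p = w₀ := by
    rw [hp, smul_inv_smul₀ hε.ne']; abel
  have hquad : ((z₀.1 - w₀.1) ^ 2 + (z₀.2 - w₀.2) ^ 2) / (2 * ε) =
      ε * (p.1 ^ 2 + p.2 ^ 2) / 2 := by
    have e1 : z₀.1 - w₀.1 = -(ε * p.1) := by rw [hp1]; ring
    have e2 : z₀.2 - w₀.2 = -(ε * p.2) := by rw [hp2]; ring
    rw [e1, e2]; field_simp
  refine ⟨z₀, p, ⟨by linarith, by linarith⟩, ⟨by linarith, by linarith⟩, hzp ▸ hw₀.1, ?_, ?_, ?_⟩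
  · rw [hzp, ← hquad]; exact hdist
  · have ha : HasDerivAt (fun s : ℝ => (z₀.1 - s) ^ 2 / (2 * ε) + lam / (1 - s))
        ((w₀.1 - z₀.1) / ε + lam / (1 - w₀.1) ^ 2) w₀.1 :=
      (hasDerivAt_sq_div _ _ _).add (hasDerivAt_div_one_sub lam (by linarith))
    have hb := hasDerivAt_sq_div z₀.2 ε w₀.2
    have h1 := hsub.2 w₀ hw₀Q
      (fun w => ((z₀.1 - w.1) ^ 2 / (2 * ε) + lam / (1 - w.1)) + (z₀.2 - w.2) ^ 2 / (2 * ε)) ?_ ?_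
    · rw [dt_add_separate (a := fun s => (z₀.1 - s) ^ 2 / (2 * ε) + lam / (1 - s))
          (b := fun s => (z₀.2 - s) ^ 2 / (2 * ε)) ha hb,
        dx_add_separate (a := fun s => (z₀.1 - s) ^ 2 / (2 * ε) + lam / (1 - s))
          (b := fun s => (z₀.2 - s) ^ 2 / (2 * ε)) ha hb] at h1
      have e1 : (w₀.1 - z₀.1) / ε = p.1 := by rw [← hp1]; field_simp
      have e2 : (w₀.2 - z₀.2) / ε = p.2 := by rw [← hp2]; field_simp
      rw [e1, e2] at h1
      have h2 : lam ≤ lam / (1 - w₀.1) ^ 2 := by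
        have h3 : 0 < 1 - w₀.1 := by linarith
        rw [le_div_iff₀ (by positivity)]
        exact mul_le_of_le_one_right hlam0.le (pow_le_one₀ h3.le (by linarith))
      linarith
    · have : (1 : ℝ) - w₀.1 ≠ 0 := by linarith
      refine ContDiffAt.add (ContDiffAt.add (by fun_prop)
        (ContDiffAt.div (by fun_prop) (by fun_prop) this)) (by fun_prop)
    · have hopen : IsOpen (Q ∩ {w : ℝ × ℝ | w.1 < 1 - 2 * ρ}) :=
        isOpen_Q.inter (isOpen_lt (by fun_prop) (by fun_prop))
      filter_upwards [hopen.mem_nhds ⟨hw₀Q, hw4⟩] with w hw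
      have h3 := hmax' z₀ hz₀ w ⟨subset_closure hw.1, (show w.1 < _ from hw.2).le⟩
      rw [add_div, add_div] at h3
      linarith
  · intro z hz
    have h1 := hmax' z hz w₀ hw₀
    -- Expanding the square around `z₀` turns maximality in `z` into touching from below, with slope
    -- `p = (w₀ - z₀)/ε`, the spatial part of which is also that of the test function at `w₀`.
    have e1 : ((z.1 - w₀.1) ^ 2 + (z.2 - w₀.2) ^ 2) / (2 * ε) =
        ((z.1 - z₀.1) ^ 2 + (z.2 - z₀.2) ^ 2) / (2 * ε) + ε * (p.1 ^ 2 + p.2 ^ 2) / 2 -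
          (p.1 * (z.1 - z₀.1) + p.2 * (z.2 - z₀.2)) := by
      have e1 : z.1 - w₀.1 = z.1 - z₀.1 - ε * p.1 := by rw [hp1]; ring
      have e2 : z.2 - w₀.2 = z.2 - z₀.2 - ε * p.2 := by rw [hp2]; ring
      rw [e1, e2]; field_simp; ring
    rw [e1, hquad] at h1
    linarith

theorem exists_mem_closedBoundary_near {w : ℝ × ℝ} {r : ℝ} (hw : w ∈ closure Q)
    (h : w.1 ≤ r ∨ w.2 ≤ r ∨ 1 - r ≤ w.2) :
    ∃ ζ ∈ closedBoundary, |w.1 - ζ.1| + |w.2 - ζ.2| ≤ r := by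
  obtain ⟨⟨a1, a2⟩, a3, a4⟩ := mem_closure_Q.1 hw
  rcases h with h | h | h
  · refine ⟨(0, w.2), ⟨mem_closure_Q.2 ⟨by simp, a3, a4⟩, Or.inl rfl⟩, ?_⟩
    simpa only [sub_self, sub_zero, abs_zero, add_zero, abs_of_nonneg a1] using h
  · refine ⟨(w.1, 0), ⟨mem_closure_Q.2 ⟨⟨a1, a2⟩, by simp⟩, Or.inr (Or.inl rfl)⟩, ?_⟩
    simpa only [sub_self, sub_zero, abs_zero, zero_add, abs_of_nonneg a3] using h
  · refine ⟨(w.1, 1), ⟨mem_closure_Q.2 ⟨⟨a1, a2⟩, by simp⟩, Or.inr (Or.inr rfl)⟩, ?_⟩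
    rw [sub_self, abs_zero, abs_of_nonpos (by linarith)]; linarith

/-- The comparison principle. -/
theorem IsViscositySubsolution.le_of_le_closedBoundary {v g : ℝ × ℝ → ℝ}
    (hv : ContinuousOn v (closure Q)) (hg : ContinuousOn g (closure Q))
    (hsub : IsViscositySubsolution Q v) (hsup : IsViscositySupersolution Q g)
    (hbd : ∀ z ∈ closedBoundary, v z ≤ g z) {z₁ : ℝ × ℝ} (hz₁ : z₁ ∈ Q) : v z₁ ≤ g z₁ := by
  by_contra! hcon
  set m := v z₁ - g z₁ with hm
  have hm0 : 0 < m := sub_pos.2 hcon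
  have ht : z₁.1 < 1 := (mem_Q.1 hz₁).1.2
  obtain ⟨B, hB⟩ := isCompact_closure_Q.exists_bound_of_continuousOn (hv.sub hg)
  obtain ⟨G, hG⟩ := isCompact_closure_Q.exists_bound_of_continuousOn hg
  have hB' : ∀ w ∈ closure Q, v w - g w ≤ B := fun w hw => (le_abs_self _).trans (hB w hw)
  have hB0 : 0 < B := hm0.trans_le (hB' z₁ (subset_closure hz₁))
  have hG0 : 0 ≤ G := (norm_nonneg _).trans (hG z₁ (subset_closure hz₁))
  obtain ⟨r₁, hr₁, hu₁⟩ := Metric.uniformContinuousOn_iff.1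
    (isCompact_closure_Q.uniformContinuousOn_of_continuous hg) (m / 8) (by positivity)
  obtain ⟨r₂, hr₂, hu₂⟩ := Metric.uniformContinuousOn_iff.1
    (isCompact_closure_Q.uniformContinuousOn_of_continuous (hv.sub hg)) (m / 4) (by positivity)
  have hθ : 0 < 1 - z₁.1 := sub_pos.2 ht
  obtain ⟨ρ, hρ0, hρ⟩ := exists_between
    (show 0 < min (r₁ / 3) (min (r₂ / 3) (m * (1 - z₁.1) / (4 * B))) from
      lt_min (by positivity) (lt_min (by positivity) (by positivity)))
  obtain ⟨hρ1, hρ2, hρ3⟩ : ρ < r₁ / 3 ∧ ρ < r₂ / 3 ∧ ρ < m * (1 - z₁.1) / (4 * B) := by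
    simpa only [lt_min_iff] using hρ
  -- As `g` oscillates by at most `2 G`, the doubled points satisfy `|z - w|² ≤ 4 G ε ≤ ρ²`.
  set ε := ρ ^ 2 / (4 * G + 4) with hε
  have hε0 : 0 < ε := by positivity
  have hclose : ∀ z ∈ closure Q, ∀ w ∈ closure Q,
      ((z.1 - w.1) ^ 2 + (z.2 - w.2) ^ 2) / (2 * ε) ≤ g w - g z →
        |z.1 - w.1| ≤ ρ ∧ |z.2 - w.2| ≤ ρ ∧ g w - g z ≤ m / 8 := by
    intro z hz w hw hle
    have hgz := (abs_le.1 (hG z hz)).1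
    have hgw := (abs_le.1 (hG w hw)).2
    have h1 : (z.1 - w.1) ^ 2 + (z.2 - w.2) ^ 2 ≤ ρ ^ 2 := by
      have h2 : (z.1 - w.1) ^ 2 + (z.2 - w.2) ^ 2 ≤ (2 * G) * (2 * ε) :=
        (div_le_iff₀ (by positivity)).1 (hle.trans (by linarith))
      have h3 : ε * (4 * G + 4) = ρ ^ 2 := by rw [hε]; field_simp
      nlinarith
    have h2 : |z.1 - w.1| ≤ ρ := abs_le_of_sq_le_sq (by nlinarith [sq_nonneg (z.2 - w.2)]) hρ0.le
    have h3 : |z.2 - w.2| ≤ ρ := abs_le_of_sq_le_sq (by nlinarith [sq_nonneg (z.1 - w.1)]) hρ0.le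
    refine ⟨h2, h3, ?_⟩
    have h4 : dist w z < r₁ := by
      rw [dist_comm]
      refine max_lt ?_ ?_ <;> rw [Real.dist_eq] <;> linarith
    exact (le_abs_self _).trans (hu₁ w hw z hz h4).le
  have hbdry : ∀ w ∈ closure Q, w.1 ≤ 2 * ρ ∨ w.2 ≤ 2 * ρ ∨ 1 - 2 * ρ ≤ w.2 →
      v w - g w ≤ m / 4 := by
    intro w hw hnear
    obtain ⟨ζ, hζ, hd⟩ := exists_mem_closedBoundary_near hw hnear
    have h4 : dist w ζ < r₂ := by
      have a1 := abs_nonneg (w.1 - ζ.1)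
      have a2 := abs_nonneg (w.2 - ζ.2)
      refine max_lt ?_ ?_ <;> rw [Real.dist_eq] <;> linarith
    have h5 := (le_abs_self _).trans (hu₂ w hw ζ hζ.1 h4).le
    have h6 := hbd ζ hζ
    simp only [Pi.sub_apply] at h5
    linarith
  have hρB : 2 * ρ * B ≤ m * (1 - z₁.1) / 2 := by
    rw [lt_div_iff₀ (by positivity)] at hρ3
    linarith
  obtain ⟨z₀, p, h1, h2, -, -, h5, h6⟩ := exists_touching_paraboloid hv hg hsub hm0 hρ0 ht hz₁
    le_rfl le_rfl hclose hbdry hB' hρB hε0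
  have hz₀ : z₀ ∈ Q := mem_Q.2 ⟨⟨by linarith, by linarith⟩, by linarith, by linarith⟩
  have hder : ∀ q c : ℝ, HasDerivAt (fun s : ℝ => q * (s - c) - (c - s) ^ 2 / (2 * ε)) q c := by
    intro q c
    have := (((hasDerivAt_id c).sub_const c).const_mul q).sub (hasDerivAt_sq_div c ε c)
    refine this.congr_deriv ?_
    simp
  have h7 := hsup.2 z₀ hz₀ (fun w => (p.1 * (w.1 - z₀.1) - (z₀.1 - w.1) ^ 2 / (2 * ε)) +
    (p.2 * (w.2 - z₀.2) - (z₀.2 - w.2) ^ 2 / (2 * ε))) (by fun_prop) ?_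
  · rw [dt_add_separate (a := fun s => p.1 * (s - z₀.1) - (z₀.1 - s) ^ 2 / (2 * ε))
        (b := fun s => p.2 * (s - z₀.2) - (z₀.2 - s) ^ 2 / (2 * ε)) (hder _ _) (hder _ _),
      dx_add_separate (a := fun s => p.1 * (s - z₀.1) - (z₀.1 - s) ^ 2 / (2 * ε))
        (b := fun s => p.2 * (s - z₀.2) - (z₀.2 - s) ^ 2 / (2 * ε)) (hder _ _) (hder _ _)] at h7
    have : 0 < m * (1 - z₁.1) / 2 := by positivity
    linarith
  · filter_upwards [isOpen_Q.mem_nhds hz₀] with w hw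
    have h8 := h6 w (subset_closure hw)
    rw [add_div, ← neg_sub z₀.1 w.1, ← neg_sub z₀.2 w.2, neg_sq, neg_sq] at h8
    simp only [sub_self, mul_zero, ne_eq, OfNat.ofNat_ne_zero, not_false_eq_true, zero_pow,
      zero_div, add_zero, sub_zero]
    linarith

/-- The data are prescribed without the corners; by continuity they determine the values there too,
as comparison requires. -/
theorem closedBoundary_subset_closure : closedBoundary ⊆ closure parabolicBoundary := by
  rintro ⟨t, x⟩ ⟨hz, h⟩
  obtain ⟨⟨a1, a2⟩, a3, a4⟩ := mem_closure_Q.1 hz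
  rw [parabolicBoundary, closure_union, closure_prod_eq, closure_prod_eq,
    closure_Ioo zero_ne_one]
  rcases h with h | h
  · exact Or.inl ⟨subset_closure h, a3, a4⟩
  · exact Or.inr ⟨⟨a1, a2⟩, subset_closure h⟩

theorem IsViscositySolutionWithData.eqOn {h v w : ℝ × ℝ → ℝ}
    (hv : IsViscositySolutionWithData h v) (hw : IsViscositySolutionWithData h w) :
    EqOn v w (closure Q) := by
  have h0 : EqOn v w closedBoundary :=
    EqOn.of_subset_closure (s := parabolicBoundary)
      (fun z hz => (hv.boundary z hz).trans (hw.boundary z hz).symm)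
      (hv.continuousOn.mono fun z hz => hz.1) (hw.continuousOn.mono fun z hz => hz.1)
      (fun z hz => mem_closedBoundary_of_mem_parabolicBoundary hz) closedBoundary_subset_closure
  have h1 : EqOn v w Q := fun z hz => le_antisymm
    (hv.sub.le_of_le_closedBoundary hv.continuousOn hw.continuousOn hw.super
      (fun z hz => (h0 hz).le) hz)
    (hw.sub.le_of_le_closedBoundary hw.continuousOn hv.continuousOn hv.super
      (fun z hz => (h0 hz).ge) hz)
  exact h1.of_subset_closure hv.continuousOn hw.continuousOn subset_closure subset_rfl

end BurgersHJ

/-! ### Testing the entropy production with Lipschitz functions. -/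

namespace BurgersHJ

open Filter Topology Metric ContinuousLinearMap
open scoped Convolution NNReal Pointwise

/-- Convolution of a function of the plane with a normed bump function. -/
noncomputable def mollify (φ : ContDiffBump (0 : ℝ × ℝ)) (W : ℝ × ℝ → ℝ) : ℝ × ℝ → ℝ :=
  φ.normed volume ⋆[lsmul ℝ ℝ, volume] W

theorem contDiff_mollify (φ : ContDiffBump (0 : ℝ × ℝ)) {W : ℝ × ℝ → ℝ} (hW : Continuous W) :
    ContDiff ℝ ∞ (mollify φ W) :=
  φ.hasCompactSupport_normed.contDiff_convolution_left _ φ.contDiff_normed hW.locallyIntegrable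

/-- Letting the derivative fall on `W` gives uniform bounds on the mollified gradients and their
almost-everywhere convergence. -/
theorem fderiv_mollify_apply (φ : ContDiffBump (0 : ℝ × ℝ)) {W : ℝ × ℝ → ℝ} {K : ℝ≥0}
    (hW : LipschitzWith K W) (z v : ℝ × ℝ) :
    fderiv ℝ (mollify φ W) z v = mollify φ (fun w => fderiv ℝ W w v) z := by
  have hφ : Continuous (φ.normed (volume : Measure (ℝ × ℝ))) := φ.continuous_normed
  have hint : ∀ z : ℝ × ℝ, Integrable fun t => φ.normed volume t * W (z - t) := fun z =>
    (hφ.mul (hW.continuous.comp (by fun_prop))).integrable_of_hasCompactSupport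
      φ.hasCompactSupport_normed.mul_right
  have hmeas : Measurable fun t : ℝ × ℝ => fderiv ℝ W (z - t) :=
    (measurable_fderiv ℝ W).comp (measurable_const.sub measurable_id)
  have hdiff : ∀ᵐ t : ℝ × ℝ, DifferentiableAt ℝ W (z - t) :=
    (Measure.measurePreserving_sub_left volume z).quasiMeasurePreserving.ae hW.ae_differentiableAt
  obtain ⟨h1, h2⟩ := hasFDerivAt_integral_of_dominated_loc_of_lip (𝕜 := ℝ)
    (μ := (volume : Measure (ℝ × ℝ)))
    (F := fun z t => φ.normed volume t * W (z - t)) (x₀ := z)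
    (F' := fun t => φ.normed volume t • fderiv ℝ W (z - t))
    (bound := fun t => φ.normed volume t * K) (s := univ) univ_mem
    (Eventually.of_forall fun z => (hint z).aestronglyMeasurable) (hint z)
    (hφ.measurable.smul hmeas).aestronglyMeasurable
    (Eventually.of_forall fun t => LipschitzOnWith.of_dist_le_mul fun a _ b _ => by
      have h3 : 0 ≤ φ.normed volume t * (K : ℝ) := mul_nonneg (φ.nonneg_normed t) K.2
      rw [Real.coe_nnabs, abs_of_nonneg h3, Real.dist_eq,
        ← mul_sub, abs_mul, abs_of_nonneg (φ.nonneg_normed t), mul_assoc]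
      refine mul_le_mul_of_nonneg_left ?_ (φ.nonneg_normed t)
      rw [← Real.dist_eq]
      refine (hW.dist_le_mul _ _).trans_eq ?_
      rw [dist_sub_right])
    (φ.integrable_normed.mul_const _)
    (hdiff.mono fun t ht => by
      have h3 : HasFDerivAt (fun z : ℝ × ℝ => z - t) (ContinuousLinearMap.id ℝ (ℝ × ℝ)) z :=
        (hasFDerivAt_id z).sub_const t
      have h4 := (ht.hasFDerivAt.comp z h3).const_mul (φ.normed volume t)
      simpa using h4)
  have h5 : mollify φ W = fun z => ∫ t, φ.normed volume t * W (z - t) := by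
    ext z; simp [mollify, convolution_def]
  rw [h5, h2.fderiv, ContinuousLinearMap.integral_apply h1]
  simp [mollify, convolution_def]

theorem abs_mollify_le (φ : ContDiffBump (0 : ℝ × ℝ)) {g : ℝ × ℝ → ℝ} {M : ℝ}
    (hg : Measurable g) (hM : ∀ z, |g z| ≤ M) (z : ℝ × ℝ) : |mollify φ g z| ≤ 3 * M := by
  have h1 : dist (mollify φ g z) (g z) ≤ 2 * M :=
    φ.dist_normed_convolution_le hg.aestronglyMeasurable fun x _ => by
      rw [Real.dist_eq]
      exact (abs_sub _ _).trans (by linarith [hM x, hM z])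
  rw [Real.dist_eq] at h1
  have h2 := abs_sub_abs_le_abs_sub (mollify φ g z) (g z)
  linarith [hM z]

theorem support_mollify_subset (φ : ContDiffBump (0 : ℝ × ℝ)) (W : ℝ × ℝ → ℝ) {δ : ℝ}
    (hδ : φ.rOut ≤ δ) : Function.support (mollify φ W) ⊆ cthickening δ (tsupport W) := by
  refine (support_convolution_subset_swap _).trans ?_
  rintro _ ⟨x, hx, y, hy, rfl⟩
  rw [φ.support_normed_eq] at hy
  refine mem_cthickening_of_dist_le _ x _ _ (subset_tsupport W hx) ?_
  rw [dist_self_add_left]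
  exact (mem_ball_zero_iff.1 hy).le.trans hδ

/-- The bump functions supported in the balls of radius `δ / (n + 1)`. -/
noncomputable def bumpSeq {δ : ℝ} (hδ : 0 < δ) (n : ℕ) : ContDiffBump (0 : ℝ × ℝ) where
  rIn := δ / (n + 1) / 2
  rOut := δ / (n + 1)
  rIn_pos := by positivity
  rIn_lt_rOut := half_lt_self (by positivity)

theorem bumpSeq_rOut_le {δ : ℝ} (hδ : 0 < δ) (n : ℕ) : (bumpSeq hδ n).rOut ≤ δ :=
  div_le_self hδ.le (by linarith [n.cast_nonneg (α := ℝ)])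

theorem tendsto_bumpSeq_rOut {δ : ℝ} (hδ : 0 < δ) :
    Tendsto (fun n => (bumpSeq hδ n).rOut) atTop (𝓝 0) := by
  have := (tendsto_one_div_add_atTop_nhds_zero_nat (𝕜 := ℝ)).const_mul δ
  simpa [bumpSeq, div_eq_mul_inv] using this

/-- The entropy production may be tested with Lipschitz functions. -/
theorem IsEntropyProduction.integral_eq_of_lipschitz {u W : ℝ × ℝ → ℝ} {μ : SignedRadonMeasure Q}
    (hμ : IsEntropyProduction Q u μ) (hu : Measurable u) {M : ℝ} (huM : ∀ z ∈ Q, |u z| ≤ M)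
    {K : ℝ≥0} (hW : LipschitzWith K W) (hWc : HasCompactSupport W) (hWQ : tsupport W ⊆ Q) :
    μ.integral W = -∫ z in Q, ((u z) ^ 2 / 2 * dt W z + (u z) ^ 3 / 3 * dx W z) := by
  -- All mollified functions live in one compact `S ⊆ Q`, on which both parts of `μ` are finite;
  -- this permits dominated convergence.
  obtain ⟨δ, hδ, hδQ⟩ := hWc.isCompact.exists_cthickening_subset_open isOpen_Q hWQ
  set S := cthickening δ (tsupport W) with hS
  have hSc : IsCompact S := hWc.isCompact.cthickening
  let ψ : ℕ → ℝ × ℝ → ℝ := fun n => mollify (bumpSeq hδ n) W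
  have hsupp : ∀ n, Function.support (ψ n) ⊆ S := fun n =>
    support_mollify_subset _ _ (bumpSeq_rOut_le hδ n)
  have hψsmooth : ∀ n, ContDiff ℝ ∞ (ψ n) := fun n => contDiff_mollify _ hW.continuous
  have hψts : ∀ n, tsupport (ψ n) ⊆ S := fun n =>
    closure_minimal (hsupp n) isClosed_cthickening
  have hψc : ∀ n, HasCompactSupport (ψ n) := fun n =>
    hSc.of_isClosed_subset (isClosed_tsupport _) (hψts n)
  have heq : ∀ n, μ.integral (ψ n) =
      -∫ z in Q, ((u z) ^ 2 / 2 * dt (ψ n) z + (u z) ^ 3 / 3 * dx (ψ n) z) := fun n =>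
    hμ (ψ n) (hψsmooth n) (hψc n) ((hψts n).trans hδQ)
  obtain ⟨A, hA⟩ := hWc.exists_bound_of_continuous hW.continuous
  have hψA : ∀ n z, |ψ n z| ≤ S.indicator (fun _ => 3 * A) z := by
    intro n z
    by_cases hz : z ∈ S
    · rw [indicator_of_mem hz]
      exact abs_mollify_le _ hW.continuous.measurable hA z
    · rw [indicator_of_notMem hz, Function.notMem_support.1 fun h => hz (hsupp n h), abs_zero]
  have hlim : ∀ ν : Measure (ℝ × ℝ), ν S < ⊤ →
      Tendsto (fun n => ∫ z, ψ n z ∂ν) atTop (𝓝 (∫ z, W z ∂ν)) := by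
    intro ν hν
    refine tendsto_integral_of_dominated_convergence (S.indicator fun _ => 3 * A)
      (fun n => (hψsmooth n).continuous.aestronglyMeasurable) ?_
      (fun n => Eventually.of_forall (hψA n)) (Eventually.of_forall fun z => ?_)
    · exact (integrable_indicator_iff isClosed_cthickening.measurableSet).2
        (integrableOn_const hν.ne)
    · exact ContDiffBump.convolution_tendsto_right_of_continuous (tendsto_bumpSeq_rOut hδ)
        hW.continuous z
  have hL : Tendsto (fun n => μ.integral (ψ n)) atTop (𝓝 (μ.integral W)) :=
    (hlim _ (μ.posPart_lt_top S hδQ hSc)).sub (hlim _ (μ.negPart_lt_top S hδQ hSc))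
  have hbd : ∀ z v : ℝ × ℝ, |fderiv ℝ W z v| ≤ K * ‖v‖ := fun z v =>
    ((fderiv ℝ W z).le_opNorm v).trans
      (mul_le_mul_of_nonneg_right (norm_fderiv_le_of_lipschitz ℝ hW) (norm_nonneg _))
  have hmeas : ∀ v : ℝ × ℝ, Measurable fun z => fderiv ℝ W z v := measurable_fderiv_apply_const ℝ W
  have hderlim : ∀ v : ℝ × ℝ, ∀ᵐ z : ℝ × ℝ,
      Tendsto (fun n => fderiv ℝ (ψ n) z v) atTop (𝓝 (fderiv ℝ W z v)) := by
    intro v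
    have hloc : LocallyIntegrable (fun z => fderiv ℝ W z v) volume := by
      refine (locallyIntegrable_const (K * ‖v‖ : ℝ)).mono (hmeas v).aestronglyMeasurable ?_
      refine Eventually.of_forall fun z => (hbd z v).trans (le_abs_self _)
    -- Lebesgue differentiation needs comparable inner and outer radii; in `bumpSeq` their ratio is
    -- 2.
    filter_upwards [ContDiffBump.ae_convolution_tendsto_right_of_locallyIntegrable
      (φ := bumpSeq hδ) (K := 2) (tendsto_bumpSeq_rOut hδ)
      (Eventually.of_forall fun n => by simp only [bumpSeq]; linarith) hloc] with z hz
    refine hz.congr fun n => ?_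
    exact (fderiv_mollify_apply _ hW z v).symm
  have hderbd : ∀ n (z v : ℝ × ℝ), |fderiv ℝ (ψ n) z v| ≤ 3 * (K * ‖v‖) := by
    intro n z v
    rw [show fderiv ℝ (ψ n) z v = _ from fderiv_mollify_apply _ hW z v]
    exact abs_mollify_le _ (hmeas v) (fun z => hbd z v) z
  have hQfin : volume Q ≠ ⊤ :=
    (isCompact_closure_Q.measure_lt_top.trans_le' (measure_mono subset_closure)).ne
  have hR : Tendsto (fun n => ∫ z in Q, ((u z) ^ 2 / 2 * dt (ψ n) z + (u z) ^ 3 / 3 * dx (ψ n) z))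
      atTop (𝓝 (∫ z in Q, ((u z) ^ 2 / 2 * dt W z + (u z) ^ 3 / 3 * dx W z))) := by
    refine tendsto_integral_of_dominated_convergence
      (fun _ => M ^ 2 / 2 * (3 * (K * ‖((1 : ℝ), (0 : ℝ))‖)) +
        M ^ 3 / 3 * (3 * (K * ‖((0 : ℝ), (1 : ℝ))‖))) (fun n => ?_)
      (integrableOn_const hQfin) (fun n => ?_) ?_
    · exact ((((hu.pow_const 2).div_const 2).mul (measurable_fderiv_apply_const ℝ _ _)).add
        (((hu.pow_const 3).div_const 3).mul
          (measurable_fderiv_apply_const ℝ _ _))).aestronglyMeasurable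
    · refine (ae_restrict_iff' isOpen_Q.measurableSet).2 (Eventually.of_forall fun z hz => ?_)
      have hM := huM z hz
      have hM0 : 0 ≤ M := (abs_nonneg _).trans hM
      refine (abs_add_le _ _).trans (add_le_add ?_ ?_)
      · rw [abs_mul, abs_div, abs_pow, abs_two]
        exact mul_le_mul (by gcongr) (hderbd n z _) (abs_nonneg _) (by positivity)
      · rw [abs_mul, abs_div, abs_pow, abs_of_pos (by norm_num : (0 : ℝ) < 3)]
        exact mul_le_mul (by gcongr) (hderbd n z _) (abs_nonneg _) (by positivity)
    · refine ae_restrict_of_ae ?_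
      filter_upwards [hderlim (1, 0), hderlim (0, 1)] with z h1 h2
      exact (h1.const_mul _).add (h2.const_mul _)
  exact tendsto_nhds_unique hL ((hR.neg).congr fun n => (heq n).symm)

theorem integral_fderiv_apply_eq_zero {W : ℝ × ℝ → ℝ} {K : ℝ≥0} (hW : LipschitzWith K W)
    (hWc : HasCompactSupport W) (v : ℝ × ℝ) : ∫ z, fderiv ℝ W z v = 0 := by
  have h1 := (LipschitzWith.const (1 : ℝ)).integral_lineDeriv_mul_eq
    (μ := (volume : Measure (ℝ × ℝ))) hW hWc (-v)
  have h2 : ∀ z w : ℝ × ℝ, lineDeriv ℝ (fun _ : ℝ × ℝ => (1 : ℝ)) z w = 0 := fun z w => by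
    simp [lineDeriv]
  simp only [h2, zero_mul, integral_zero, neg_neg, mul_one] at h1
  rw [h1]
  refine integral_congr_ae ?_
  filter_upwards [hW.ae_differentiableAt] with z hz
  rw [hz.lineDeriv_eq_fderiv]

theorem setIntegral_fderiv_apply_eq_zero {W : ℝ × ℝ → ℝ} {K : ℝ≥0} (hW : LipschitzWith K W)
    (hWc : HasCompactSupport W) {U : Set (ℝ × ℝ)} (hWU : tsupport W ⊆ U) (v : ℝ × ℝ) :
    ∫ z in U, fderiv ℝ W z v = 0 := by
  rw [setIntegral_eq_integral_of_forall_compl_eq_zero, integral_fderiv_apply_eq_zero hW hWc]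
  intro z hz
  have : fderiv ℝ W z = 0 := by
    by_contra h
    exact hz (hWU (support_fderiv_subset ℝ (Function.mem_support.2 h)))
  rw [this]; rfl

/-- A point of the small ball and one off the large ball are at least `ρ - r` apart, so the bound
`M` controls the quotient. This gives a global Lipschitz constant although `h` is controlled only on
the closed square. -/
theorem exists_lipschitzWith_of_eq_zero_off_closedBall {W : ℝ × ℝ → ℝ} {z₀ : ℝ × ℝ} {r ρ M : ℝ}
    {K : ℝ≥0} (hrρ : r < ρ) (hK : LipschitzOnWith K W (closedBall z₀ ρ))
    (h0 : ∀ z ∉ closedBall z₀ r, W z = 0) (hM : ∀ z, |W z| ≤ M) :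
    ∃ K' : ℝ≥0, LipschitzWith K' W := by
  have hM0 : 0 ≤ M := (abs_nonneg _).trans (hM z₀)
  have hd : 0 < ρ - r := sub_pos.2 hrρ
  have hsub : closedBall z₀ r ⊆ closedBall z₀ ρ := closedBall_subset_closedBall hrρ.le
  have key : ∀ a ∈ closedBall z₀ r, ∀ b,
      dist (W a) (W b) ≤ (K + (M / (ρ - r)).toNNReal : ℝ≥0) * dist a b := by
    intro a ha b
    have e : ((K + (M / (ρ - r)).toNNReal : ℝ≥0) : ℝ) = K + M / (ρ - r) := by
      rw [NNReal.coe_add, Real.coe_toNNReal _ (by positivity)]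
    rw [e, add_mul]
    by_cases hb : b ∈ closedBall z₀ ρ
    · have := hK.dist_le_mul a (hsub ha) b hb
      have h2 : 0 ≤ M / (ρ - r) * dist a b := by positivity
      linarith
    · rw [h0 b fun h => hb (hsub h), Real.dist_eq, sub_zero]
      have h1 : ρ - r ≤ dist a b := by
        rw [mem_closedBall, not_le] at hb
        have h3 := dist_triangle b a z₀
        rw [mem_closedBall] at ha
        rw [dist_comm a b]; linarith
      have h2 : M ≤ M / (ρ - r) * dist a b := by
        rw [div_mul_eq_mul_div, le_div_iff₀ hd]
        exact mul_le_mul_of_nonneg_left h1 hM0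
      have h3 : 0 ≤ (K : ℝ) * dist a b := by positivity
      linarith [hM a]
  refine ⟨K + (M / (ρ - r)).toNNReal, LipschitzWith.of_dist_le_mul fun a b => ?_⟩
  by_cases ha : a ∈ closedBall z₀ r
  · exact key a ha b
  · by_cases hb : b ∈ closedBall z₀ r
    · rw [dist_comm, dist_comm a b]; exact key b hb a
    · rw [h0 a ha, h0 b hb, dist_self]; positivity

end BurgersHJ

/-! ### A touching paraboloid forces positive entropy, and the resulting bound on the gap. -/

namespace BurgersHJ

open Filter Topology Metric
open scoped NNReal

variable {L : ℝ} {h : ℝ × ℝ → ℝ}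

theorem mem_Q_of_mem_closedBall {z₀ z : ℝ × ℝ} {ρ : ℝ} (h1 : ρ < z₀.1 ∧ z₀.1 < 1 - ρ)
    (h2 : ρ < z₀.2 ∧ z₀.2 < 1 - ρ) (hz : z ∈ closedBall z₀ ρ) : z ∈ Q := by
  have a1 : |z.1 - z₀.1| ≤ ρ := (le_max_left _ _).trans (mem_closedBall.1 hz)
  have a2 : |z.2 - z₀.2| ≤ ρ := (le_max_right _ _).trans (mem_closedBall.1 hz)
  have b1 := abs_le.1 a1
  have b2 := abs_le.1 a2
  exact mem_Q.2 ⟨⟨by linarith, by linarith⟩, by linarith, by linarith⟩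

theorem abs_dx_le (hL : 0 ≤ L) (hh : EuclideanLipschitzOn L h (closure Q)) {z : ℝ × ℝ}
    (hz : z ∈ Q) : |dx h z| ≤ 2 * L := by
  have h1 := norm_fderiv_le_of_lipschitzOn ℝ (mem_of_superset (isOpen_Q.mem_nhds hz) subset_closure)
    (hh.lipschitzOnWith hL)
  rw [Real.coe_toNNReal _ (by positivity)] at h1
  have h2 := (fderiv ℝ h z).le_opNorm (0, 1)
  have h3 : ‖((0 : ℝ), (1 : ℝ))‖ = 1 := by simp [Prod.norm_def]
  rw [h3, mul_one] at h2
  exact h2.trans h1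

theorem ae_differentiableAt_of_euclideanLipschitzOn (hL : 0 ≤ L)
    (hh : EuclideanLipschitzOn L h (closure Q)) :
    ∀ᵐ z ∂(volume.restrict Q), DifferentiableAt ℝ h z := by
  refine (ae_restrict_iff' isOpen_Q.measurableSet).2 ?_
  filter_upwards [(hh.lipschitzOnWith hL).ae_differentiableWithinAt_of_mem] with z hz hzQ
  exact (hz (subset_closure hzQ)).differentiableAt
    (mem_of_superset (isOpen_Q.mem_nhds hzQ) subset_closure)

/-- The algebra behind the entropy estimate: `u` is the slope of the solution, `k` that of the test
function, `δ` the defect of the test function in the equation. -/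
theorem defect_sq_le {L u k δ lam e₁ e₂ σ : ℝ} (hL : 1 ≤ L) (hu : |u| ≤ 2 * L)
    (hk : |k| ≤ 3 * L) (hlam : 0 ≤ lam) (hδ : lam ≤ δ) (hδL : δ ≤ 3 * L) (he₁ : |e₁| ≤ σ)
    (he₂ : |e₂| ≤ σ) (hσ : 20 * L ^ 3 * σ ≤ lam ^ 2 / 2) :
    lam ^ 2 / 2 ≤ (k ^ 2 / 2 - δ - u ^ 2 / 2) * (-(k ^ 2 / 2) - δ + u ^ 2 / 2 + e₁) +
      (k ^ 3 / 3 - u ^ 3 / 3) * (k - u + e₂) := by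
  have hσ0 : 0 ≤ σ := (abs_nonneg _).trans he₁
  have hu2 : u ^ 2 ≤ 4 * L ^ 2 := by
    have := sq_le_sq' (abs_le.1 hu).1 (abs_le.1 hu).2; linarith
  have hk2 : k ^ 2 ≤ 9 * L ^ 2 := by
    have := sq_le_sq' (abs_le.1 hk).1 (abs_le.1 hk).2; linarith
  have hu3 : |u ^ 3| ≤ 8 * L ^ 3 := by
    rw [abs_pow]; calc |u| ^ 3 ≤ (2 * L) ^ 3 := by gcongr
      _ = 8 * L ^ 3 := by ring
  have hk3 : |k ^ 3| ≤ 27 * L ^ 3 := by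
    rw [abs_pow]; calc |k| ^ 3 ≤ (3 * L) ^ 3 := by gcongr
      _ = 27 * L ^ 3 := by ring
  have hL2 : L ≤ L ^ 2 := by nlinarith
  have hL3 : L ^ 2 ≤ L ^ 3 := by nlinarith [sq_nonneg L]
  have a1 : |k ^ 2 / 2 - δ - u ^ 2 / 2| ≤ 8 * L ^ 3 := by
    rw [abs_le]; constructor <;> nlinarith [sq_nonneg u, sq_nonneg k]
  have a2 : |k ^ 3 / 3 - u ^ 3 / 3| ≤ 12 * L ^ 3 := by
    have := abs_le.1 hu3
    have := abs_le.1 hk3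
    have : 0 ≤ L ^ 3 := by positivity
    rw [abs_le]; constructor <;> linarith
  have b1 : -(8 * L ^ 3 * σ) ≤ (k ^ 2 / 2 - δ - u ^ 2 / 2) * e₁ := by
    refine (abs_le.1 ?_).1
    rw [abs_mul]
    exact mul_le_mul a1 he₁ (abs_nonneg _) (by positivity)
  have b2 : -(12 * L ^ 3 * σ) ≤ (k ^ 3 / 3 - u ^ 3 / 3) * e₂ := by
    refine (abs_le.1 ?_).1
    rw [abs_mul]
    exact mul_le_mul a2 he₂ (abs_nonneg _) (by positivity)
  -- The identity `(k - u)(k³ - u³)/3 - (k² - u²)²/4 = (k - u)⁴/12`.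
  have c1 : (k ^ 2 / 2 - δ - u ^ 2 / 2) * (-(k ^ 2 / 2) - δ + u ^ 2 / 2 + e₁) +
      (k ^ 3 / 3 - u ^ 3 / 3) * (k - u + e₂) = (k - u) ^ 4 / 12 + δ ^ 2 +
        (k ^ 2 / 2 - δ - u ^ 2 / 2) * e₁ + (k ^ 3 / 3 - u ^ 3 / 3) * e₂ := by ring
  have c2 : lam ^ 2 ≤ δ ^ 2 := by gcongr
  have c3 : 0 ≤ (k - u) ^ 4 / 12 := by positivity
  rw [c1]
  linarith

theorem integral_le_of_le_posPart {μ : SignedRadonMeasure Q} {W : ℝ × ℝ → ℝ} {η : ℝ}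
    (hfin : μ.posPart Q ≠ ⊤) (hW0 : ∀ z, 0 ≤ W z) (hWη : ∀ z, W z ≤ η)
    (hWQ : ∀ z ∉ Q, W z = 0) : μ.integral W ≤ η * (μ.posPart Q).toReal := by
  have h1 : ∫ z, W z ∂μ.posPart ≤ ∫ z, Q.indicator (fun _ => η) z ∂μ.posPart := by
    refine integral_mono_of_nonneg (Eventually.of_forall hW0)
      ((integrable_indicator_iff isOpen_Q.measurableSet).2 (integrableOn_const hfin))
      (Eventually.of_forall fun z => ?_)
    by_cases hz : z ∈ Q
    · simp only [indicator_of_mem hz, hWη z]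
    · simp only [indicator_of_notMem hz, hWQ z hz, le_refl]
  rw [integral_indicator isOpen_Q.measurableSet, setIntegral_const, smul_eq_mul, mul_comm] at h1
  have h2 : 0 ≤ ∫ z, W z ∂μ.negPart := integral_nonneg hW0
  exact (sub_le_self _ h2).trans h1

/-- The gradient of `W` has integral zero, so constants may be added to the entropy and its flux;
they are chosen later to make the integrand positive. -/
theorem IsEntropyProduction.integral_eq_sub_const {u W : ℝ × ℝ → ℝ} {μ : SignedRadonMeasure Q}
    (hμ : IsEntropyProduction Q u μ) (hu : Measurable u) {M : ℝ} (huM : ∀ z ∈ Q, |u z| ≤ M)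
    {K : ℝ≥0} (hW : LipschitzWith K W) (hWc : HasCompactSupport W) (hWQ : tsupport W ⊆ Q)
    (c₁ c₂ : ℝ) :
    IntegrableOn (fun z => (c₁ - (u z) ^ 2 / 2) * dt W z + (c₂ - (u z) ^ 3 / 3) * dx W z) Q ∧
    μ.integral W = ∫ z in Q, ((c₁ - (u z) ^ 2 / 2) * dt W z + (c₂ - (u z) ^ 3 / 3) * dx W z) := by
  have hQfin : volume Q ≠ ⊤ :=
    (isCompact_closure_Q.measure_lt_top.trans_le' (measure_mono subset_closure)).ne
  have hWder : ∀ v : ℝ × ℝ, Measurable fun z => fderiv ℝ W z v :=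
    measurable_fderiv_apply_const ℝ W
  have hWbd : ∀ z v : ℝ × ℝ, |fderiv ℝ W z v| ≤ K * ‖v‖ := fun z v =>
    ((fderiv ℝ W z).le_opNorm v).trans
      (mul_le_mul_of_nonneg_right (norm_fderiv_le_of_lipschitz ℝ hW) (norm_nonneg _))
  have hint : ∀ (n : ℕ) (c : ℝ) (v : ℝ × ℝ),
      IntegrableOn (fun z => (u z) ^ n / c * fderiv ℝ W z v) Q := by
    intro n c v
    refine Measure.integrableOn_of_bounded (M := M ^ n / |c| * (K * ‖v‖)) hQfin
      (((hu.pow_const n).div_const c).mul (hWder v)).aestronglyMeasurable ?_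
    refine (ae_restrict_iff' isOpen_Q.measurableSet).2 (Eventually.of_forall fun z hz => ?_)
    have hM := huM z hz
    have hM0 : 0 ≤ M := (abs_nonneg _).trans hM
    rw [Real.norm_eq_abs, abs_mul, abs_div, abs_pow]
    exact mul_le_mul (by gcongr) (hWbd z v) (abs_nonneg _) (by positivity)
  have hint' : ∀ (c : ℝ) (v : ℝ × ℝ), IntegrableOn (fun z => c * fderiv ℝ W z v) Q := by
    intro c v
    have h1 := (hint 0 1 v).const_mul c
    simp only [pow_zero, div_one, one_mul] at h1
    exact h1
  have hzero : ∀ (c : ℝ) (v : ℝ × ℝ), ∫ z in Q, c * fderiv ℝ W z v = 0 := fun c v => by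
    rw [integral_const_mul, setIntegral_fderiv_apply_eq_zero hW hWc hWQ, mul_zero]
  have hA : IntegrableOn (fun z => c₁ * dt W z + c₂ * dx W z) Q :=
    (hint' c₁ (1, 0)).add (hint' c₂ (0, 1))
  have hB : IntegrableOn (fun z => (u z) ^ 2 / 2 * dt W z + (u z) ^ 3 / 3 * dx W z) Q :=
    (hint 2 2 (1, 0)).add (hint 3 3 (0, 1))
  have hA0 : ∫ z in Q, (c₁ * dt W z + c₂ * dx W z) = 0 :=
    (integral_add (hint' c₁ (1, 0)) (hint' c₂ (0, 1))).trans (by rw [hzero, hzero, add_zero])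
  have e : (fun z => (c₁ - (u z) ^ 2 / 2) * dt W z + (c₂ - (u z) ^ 3 / 3) * dx W z) =
      fun z => (c₁ * dt W z + c₂ * dx W z) -
        ((u z) ^ 2 / 2 * dt W z + (u z) ^ 3 / 3 * dx W z) := by
    ext z; ring
  rw [e]
  refine ⟨hA.sub hB, ?_⟩
  rw [integral_sub hA hB, hA0, zero_sub]
  exact hμ.integral_eq_of_lipschitz hu huM hW hWc hWQ

/-- A paraboloid with slope `p` and opening `2 / ε` at `z₀`, raised by `η` above `h`, minus `h`. -/
noncomputable def paraboloidGap (h : ℝ × ℝ → ℝ) (z₀ p : ℝ × ℝ) (ε η : ℝ) (z : ℝ × ℝ) : ℝ :=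
  (η + h z₀ + (p.1 * (z.1 - z₀.1) + p.2 * (z.2 - z₀.2)) -
    ((z.1 - z₀.1) ^ 2 + (z.2 - z₀.2) ^ 2) / ε) - h z

/-- At distance `a = η/(16 L)` the function `h` and the linear part together use up at most `8 L a =
η/2`, and the quadratic part less than `η/2`. -/
theorem paraboloidGap_pos (hL : 1 ≤ L) (hh : EuclideanLipschitzOn L h (closure Q))
    {z₀ p z : ℝ × ℝ} {ε η a : ℝ} (hε : 0 < ε) (hη : 0 < η) (hηε : η ≤ ε)
    (ha : 16 * L * a = η) (hp₁ : |p.1| ≤ 3 * L) (hp₂ : |p.2| ≤ 3 * L) (hz₀ : z₀ ∈ closure Q)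
    (hz : z ∈ closure Q) (hza : z ∈ ball z₀ a) : 0 < paraboloidGap h z₀ p ε η z := by
  have hL0 : 0 ≤ L := by linarith
  have a1 : |z.1 - z₀.1| < a := (le_max_left _ _).trans_lt (mem_ball.1 hza)
  have a2 : |z.2 - z₀.2| < a := (le_max_right _ _).trans_lt (mem_ball.1 hza)
  have ha0 : 0 < a := (abs_nonneg _).trans_lt a1
  have h1 := hh.le_add hL0 hz hz₀
  have h2 : -(3 * L * a) ≤ p.1 * (z.1 - z₀.1) := by
    refine (abs_le.1 ?_).1
    rw [abs_mul]; exact mul_le_mul hp₁ a1.le (abs_nonneg _) (by positivity)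
  have h3 : -(3 * L * a) ≤ p.2 * (z.2 - z₀.2) := by
    refine (abs_le.1 ?_).1
    rw [abs_mul]; exact mul_le_mul hp₂ a2.le (abs_nonneg _) (by positivity)
  have h4 : ((z.1 - z₀.1) ^ 2 + (z.2 - z₀.2) ^ 2) / ε < η / 2 := by
    rw [div_lt_iff₀ hε]
    have s1 : (z.1 - z₀.1) ^ 2 ≤ a ^ 2 := sq_le_sq' (abs_le.1 a1.le).1 (abs_le.1 a1.le).2
    have s2 : (z.2 - z₀.2) ^ 2 ≤ a ^ 2 := sq_le_sq' (abs_le.1 a2.le).1 (abs_le.1 a2.le).2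
    have s3 : 16 * a ≤ η := by nlinarith
    have s4 : a ^ 2 ≤ η / 16 * (ε / 16) := by
      rw [sq]; exact mul_le_mul (by linarith) (by linarith) ha0.le (by linarith)
    have s5 : 0 < η * ε := by positivity
    linarith
  have h5 : L * (|z.1 - z₀.1| + |z.2 - z₀.2|) ≤ L * (2 * a) :=
    mul_le_mul_of_nonneg_left (by linarith) hL0
  unfold paraboloidGap
  linarith

theorem fderiv_paraboloidGap {z₀ p z : ℝ × ℝ} {ε η : ℝ} (hz : DifferentiableAt ℝ h z) :
    dt (paraboloidGap h z₀ p ε η) z = p.1 + -(2 * (z.1 - z₀.1) / ε) - dt h z ∧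
      dx (paraboloidGap h z₀ p ε η) z = p.2 + -(2 * (z.2 - z₀.2) / ε) - dx h z := by
  have hder : ∀ c x₀ x : ℝ, HasDerivAt
      (fun s : ℝ => c * (s - x₀) - (s - x₀) ^ 2 / ε) (c + -(2 * (x - x₀) / ε)) x := by
    intro c x₀ x
    have := (((hasDerivAt_id x).sub_const x₀).const_mul c).sub
      ((((hasDerivAt_id x).sub_const x₀).pow 2).div_const ε)
    refine this.congr_deriv ?_
    simp only [id, Nat.cast_ofNat, Nat.add_one_sub_one, pow_one, mul_one]
    ring
  have h1 := ((hasFDerivAt_add_separate (hder p.1 z₀.1 z.1) (hder p.2 z₀.2 z.2)).const_add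
    (η + h z₀)).sub hz.hasFDerivAt
  have h2 := (h1.congr_of_eventuallyEq (f₁ := paraboloidGap h z₀ p ε η)
    (Eventually.of_forall fun w => by
      simp only [paraboloidGap, Pi.sub_apply]; ring)).fderiv
  constructor
  · simp [dt, h2]
  · simp [dx, h2]

theorem volume_real_ball {z₀ : ℝ × ℝ} {a : ℝ} (ha : 0 ≤ a) :
    volume.real (ball z₀ a) = (2 * a) ^ 2 := by
  have : ball z₀ a = ball z₀.1 a ×ˢ ball z₀.2 a := (ball_prod_same z₀.1 z₀.2 a).symm
  rw [this, Measure.real, Measure.volume_eq_prod, Measure.prod_prod, Real.volume_ball,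
    Real.volume_ball, ENNReal.toReal_mul, ENNReal.toReal_ofReal (by positivity), sq]

/-- If a paraboloid touches `h` from below with defect `lam` in the equation, then a definite amount
of positive entropy is produced. -/
theorem sq_mul_sq_le_of_touching (hL : 1 ≤ L) (hh : EuclideanLipschitzOn L h (closure Q))
    (hs : SolvesHJAE Q h) {μ : SignedRadonMeasure Q} (hμ : IsEntropyProduction Q (dx h) μ)
    (hfin : μ.posPart Q ≠ ⊤) {z₀ p : ℝ × ℝ} {lam ε ρ r : ℝ} (hlam : 0 < lam) (hε : 0 < ε)
    (hr : 0 < r) (hrρ : r < ρ) (hrε : r ≤ ε) (hrlam : 40 * L ^ 3 * r ≤ ε * (lam ^ 2 / 2))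
    (hz₁ : ρ < z₀.1 ∧ z₀.1 < 1 - ρ) (hz₂ : ρ < z₀.2 ∧ z₀.2 < 1 - ρ)
    (hp₁ : |p.1| ≤ 3 * L) (hp₂ : |p.2| ≤ 3 * L) (hdef : p.1 + p.2 ^ 2 / 2 ≤ -lam)
    (htouch : ∀ z ∈ closure Q, h z₀ + (p.1 * (z.1 - z₀.1) + p.2 * (z.2 - z₀.2)) -
        ((z.1 - z₀.1) ^ 2 + (z.2 - z₀.2) ^ 2) / (2 * ε) ≤ h z) :
    r ^ 2 * lam ^ 2 ≤ 256 * L ^ 2 * ε * (μ.posPart Q).toReal := by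
  have hL0 : 0 ≤ L := by linarith
  have hρ : 0 < ρ := hr.trans hrρ
  set η := r ^ 2 / (2 * ε) with hη
  have hη0 : 0 < η := by positivity
  have hηε : 2 * ε * η = r ^ 2 := by rw [hη]; field_simp
  set f : ℝ × ℝ → ℝ := paraboloidGap h z₀ p ε η with hf
  set W : ℝ × ℝ → ℝ := Q.indicator fun z => max (f z) 0 with hW
  have hWQ : ∀ z ∉ Q, W z = 0 := fun z hz => indicator_of_notMem hz _
  have hWmem : ∀ z ∈ Q, W z = max (f z) 0 := fun z hz => indicator_of_mem hz _
  have hW0 : ∀ z, 0 ≤ W z := fun z => indicator_nonneg (fun _ _ => le_max_right _ _) z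
  -- Doubling the curvature leaves a surplus `|z - z₀|²/(2ε)`. Thus `f > 0` only within distance
  -- `r`, by the choice `η = r²/(2ε)`.
  have hfle : ∀ z ∈ closure Q, f z ≤ η - ((z.1 - z₀.1) ^ 2 + (z.2 - z₀.2) ^ 2) / (2 * ε) := by
    intro z hz
    have h1 := htouch z hz
    have h2 : ((z.1 - z₀.1) ^ 2 + (z.2 - z₀.2) ^ 2) / ε =
        2 * (((z.1 - z₀.1) ^ 2 + (z.2 - z₀.2) ^ 2) / (2 * ε)) := by field_simp
    simp only [hf, paraboloidGap]
    linarith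
  have hWη : ∀ z, W z ≤ η := by
    intro z
    by_cases hz : z ∈ Q
    · rw [hWmem z hz]
      refine max_le ((hfle z (subset_closure hz)).trans (sub_le_self _ (by positivity))) hη0.le
    · rw [hWQ z hz]; exact hη0.le
  have hnear : ∀ z ∈ Q, 0 < f z → |z.1 - z₀.1| ≤ r ∧ |z.2 - z₀.2| ≤ r := by
    intro z hz hfz
    have h1 := hfz.trans_le (hfle z (subset_closure hz))
    rw [sub_pos, div_lt_iff₀ (by positivity)] at h1
    constructor <;> refine abs_le_of_sq_le_sq ?_ hr.le <;>
      nlinarith [sq_nonneg (z.1 - z₀.1), sq_nonneg (z.2 - z₀.2)]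
  have hWr : ∀ z ∉ closedBall z₀ r, W z = 0 := by
    intro z hz
    by_cases hzQ : z ∈ Q
    · rw [hWmem z hzQ]
      refine max_eq_right (not_lt.1 fun hfz => hz ?_)
      obtain ⟨h1, h2⟩ := hnear z hzQ hfz
      exact mem_closedBall.2 (max_le h1 h2)
    · exact hWQ z hzQ
  have hballQ : closedBall z₀ ρ ⊆ Q := fun z hz => mem_Q_of_mem_closedBall hz₁ hz₂ hz
  have hts : tsupport W ⊆ closedBall z₀ r :=
    closure_minimal (fun z hz => by_contra fun hc => hz (hWr z hc)) isClosed_closedBall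
  have hWc : HasCompactSupport W :=
    (isCompact_closedBall z₀ r).of_isClosed_subset (isClosed_tsupport _) hts
  have htsQ : tsupport W ⊆ Q :=
    hts.trans ((closedBall_subset_closedBall hrρ.le).trans hballQ)
  set q : ℝ × ℝ → ℝ := fun z => η + h z₀ + (p.1 * (z.1 - z₀.1) + p.2 * (z.2 - z₀.2)) -
    ((z.1 - z₀.1) ^ 2 + (z.2 - z₀.2) ^ 2) / ε with hq
  have hqsmooth : ContDiff ℝ 1 q := by
    simp only [hq]; fun_prop
  obtain ⟨K₁, hK₁⟩ := (hqsmooth.locallyLipschitz.locallyLipschitzOn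
    (s := closedBall z₀ ρ)).exists_lipschitzOnWith_of_compact (isCompact_closedBall z₀ ρ)
  have hfLip : LipschitzOnWith (K₁ + (2 * L).toNNReal) f (closedBall z₀ ρ) :=
    hK₁.sub ((hh.lipschitzOnWith hL0).mono (hballQ.trans subset_closure))
  have hWLip : LipschitzOnWith (K₁ + (2 * L).toNNReal) W (closedBall z₀ ρ) := by
    refine LipschitzOnWith.of_dist_le_mul fun a ha b hb => ?_
    rw [hWmem a (hballQ ha), hWmem b (hballQ hb), Real.dist_eq]
    exact (abs_max_sub_max_le_abs _ _ _).trans (hfLip.dist_le_mul a ha b hb)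
  obtain ⟨K, hK⟩ := exists_lipschitzWith_of_eq_zero_off_closedBall (M := η) hrρ hWLip hWr
    fun z => by rw [abs_of_nonneg (hW0 z)]; exact hWη z
  have hu : Measurable (dx h) := measurable_fderiv_apply_const ℝ h _
  have huL : ∀ z ∈ Q, |dx h z| ≤ 2 * L := fun z hz => abs_dx_le hL0 hh hz
  have hupper := integral_le_of_le_posPart hfin hW0 hWη hWQ
  set k := p.2 with hk
  set δ := -p.1 - k ^ 2 / 2 with hδ
  -- The shift by `-δ` in the first constant removes the cross term between `δ` and `k² - u²`.
  obtain ⟨hI, hid⟩ := hμ.integral_eq_sub_const hu huL hK hWc htsQ (k ^ 2 / 2 - δ) (k ^ 3 / 3)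
  set a := η / (16 * L) with ha
  have ha0 : 0 < a := by positivity
  have haL : 16 * L * a = η := by rw [ha]; field_simp
  have hηr : 2 * η ≤ r := by
    refine le_of_mul_le_mul_left (?_ : ε * (2 * η) ≤ ε * r) hε
    have := mul_le_mul_of_nonneg_left hrε hr.le
    linarith
  have har : a ≤ ρ := by
    have : a ≤ η := by rw [ha]; exact div_le_self hη0.le (by linarith)
    linarith
  have hz₀Q : z₀ ∈ closure Q := subset_closure (hballQ (mem_closedBall_self hρ.le))
  have hballsub : ball z₀ a ⊆ Q :=
    (ball_subset_closedBall.trans (closedBall_subset_closedBall har)).trans hballQ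
  have hballpos : ∀ z ∈ ball z₀ a, 0 < f z := fun z hz =>
    paraboloidGap_pos hL hh hε hη0 (by linarith) haL hp₁ hp₂ hz₀Q
      (subset_closure (hballsub hz)) hz
  have hpt : ∀ᵐ z ∂(volume.restrict Q), (ball z₀ a).indicator (fun _ => lam ^ 2 / 2) z ≤
      (k ^ 2 / 2 - δ - (dx h z) ^ 2 / 2) * dt W z + (k ^ 3 / 3 - (dx h z) ^ 3 / 3) * dx W z := by
    filter_upwards [hs, ae_differentiableAt_of_euclideanLipschitzOn hL0 hh,
      self_mem_ae_restrict isOpen_Q.measurableSet] with z hzs hzd hzQ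
    by_cases hfz : 0 < f z
    · have hfc : ContinuousAt f z :=
        hqsmooth.continuous.continuousAt.sub hzd.continuousAt
      have hWf : W =ᶠ[𝓝 z] f := by
        filter_upwards [isOpen_Q.mem_nhds hzQ, hfc.eventually (lt_mem_nhds hfz)] with w hw hfw
        rw [hWmem w hw, max_eq_left hfw.le]
      obtain ⟨g1, g2⟩ := fderiv_paraboloidGap (z₀ := z₀) (p := p) (ε := ε) (η := η) hzd
      have d1 : dt W z = -(k ^ 2 / 2) - δ + (dx h z) ^ 2 / 2 + -(2 * (z.1 - z₀.1) / ε) := by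
        rw [dt, hWf.fderiv_eq]
        refine g1.trans ?_
        rw [hδ]; linarith
      have d2 : dx W z = k - dx h z + -(2 * (z.2 - z₀.2) / ε) := by
        rw [dx, hWf.fderiv_eq]
        refine g2.trans ?_
        ring
      obtain ⟨n1, n2⟩ := hnear z hzQ hfz
      have hσ : ∀ x : ℝ, |x| ≤ r → |-(2 * x / ε)| ≤ 2 * r / ε := by
        intro x hx
        rw [abs_neg, abs_div, abs_mul, abs_two, abs_of_pos hε]
        gcongr
      have hδL : δ ≤ 3 * L := by
        rw [hδ]; nlinarith [(abs_le.1 hp₁).1, sq_nonneg k]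
      have hfinal := defect_sq_le hL (huL z hzQ) hp₂ hlam.le (δ := δ) (by rw [hδ]; linarith) hδL
        (hσ _ n1) (hσ _ n2) (by
          rw [mul_div_assoc', div_le_iff₀ hε]; linarith)
      have hind : (ball z₀ a).indicator (fun _ => lam ^ 2 / 2) z ≤ lam ^ 2 / 2 :=
        indicator_le_self' (fun _ _ => by positivity) z
      rw [d1, d2]
      exact hind.trans hfinal
    · have hWz : W z = 0 := by rw [hWmem z hzQ]; exact max_eq_right (not_lt.1 hfz)
      -- Where `W` vanishes it is minimal, so `fderiv` is zero there, by default if `W` is not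
      -- differentiable.
      have hmin : IsLocalMin W z := Eventually.of_forall fun w => by rw [hWz]; exact hW0 w
      have hball : z ∉ ball z₀ a := fun hb => hfz (hballpos z hb)
      have d1 : dt W z = 0 := by rw [dt, hmin.fderiv_eq_zero]; rfl
      have d2 : dx W z = 0 := by rw [dx, hmin.fderiv_eq_zero]; rfl
      rw [d1, d2, indicator_of_notMem hball, mul_zero, mul_zero, add_zero]
  have hlower : lam ^ 2 / 2 * (2 * a) ^ 2 ≤ μ.integral W := by
    have hbm : MeasurableSet (ball z₀ a) := isOpen_ball.measurableSet
    have h1 := integral_mono_ae (((integrable_indicator_iff hbm).2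
      (integrableOn_const (measure_ball_lt_top.ne))).mono_measure Measure.restrict_le_self)
      hI hpt
    rw [integral_indicator hbm, Measure.restrict_restrict hbm, inter_eq_left.2 hballsub,
      setIntegral_const, volume_real_ball ha0.le, smul_eq_mul, mul_comm] at h1
    rw [hid]; exact h1
  have hcomb := hlower.trans hupper
  set P := (μ.posPart Q).toReal with hP
  have e1 : η * (η * lam ^ 2) ≤ η * (128 * L ^ 2 * P) := by
    have : η * (η * lam ^ 2) = 128 * L ^ 2 * (lam ^ 2 / 2 * (2 * a) ^ 2) := by
      rw [← haL]; ring
    rw [this]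
    have := mul_le_mul_of_nonneg_left hcomb (by positivity : 0 ≤ 128 * L ^ 2)
    linarith
  have e2 := le_of_mul_le_mul_left e1 hη0
  rw [← hηε]
  nlinarith

/-- Completing squares gives `(|x| - c)² + (|y| - c)² ≤ 2c²`. With `c = L ε` this bounds both the
distance of the doubled points and the slope of the paraboloid. -/
theorem abs_le_of_sq_add_sq_le {x y c : ℝ} (hc : 0 < c)
    (hxy : x ^ 2 + y ^ 2 ≤ 2 * c * (|x| + |y|)) : |x| ≤ 3 * c ∧ |y| ≤ 3 * c := by
  rw [← sq_abs x, ← sq_abs y] at hxy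
  constructor
  · by_contra! h
    nlinarith [sq_nonneg (|y| - c), mul_pos (sub_pos.2 h) (sub_pos.2 h)]
  · by_contra! h
    nlinarith [sq_nonneg (|x| - c), mul_pos (sub_pos.2 h) (sub_pos.2 h)]

theorem gap_pow_le_of_estimate {L m θ ε r P : ℝ} (hL : 1 ≤ L) (hm : 0 ≤ m) (hε : 0 < ε)
    (hP : 0 ≤ P) (hmL : m ≤ 3 * L) (hεm : 144 * L ^ 2 * ε = m * θ)
    (hr : 80 * L ^ 3 * r = (m * θ / 2) ^ 2 * ε)
    (hkey : r ^ 2 * (m * θ / 2) ^ 2 ≤ 256 * L ^ 2 * ε * P) :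
    θ ^ 7 * m ^ 8 ≤ 50000000000 * L ^ 11 * P := by
  set lam := m * θ / 2 with hlam
  have e1 : ε * (lam ^ 6 * ε) ≤ ε * (1638400 * L ^ 8 * P) := by
    have h1 : ε * (lam ^ 6 * ε) = 6400 * L ^ 6 * (r ^ 2 * lam ^ 2) := by
      have : (80 * L ^ 3 * r) ^ 2 = (lam ^ 2 * ε) ^ 2 := by rw [hr]
      linear_combination (-(lam ^ 2)) * this
    rw [h1]
    have := mul_le_mul_of_nonneg_left hkey (by positivity : 0 ≤ 6400 * L ^ 6)
    linarith
  have e2 := le_of_mul_le_mul_left e1 hε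
  have e3 : θ ^ 7 * m ^ 7 = 9216 * L ^ 2 * (lam ^ 6 * ε) := by
    have : 9216 * L ^ 2 * (lam ^ 6 * ε) = 64 * lam ^ 6 * (144 * L ^ 2 * ε) := by ring
    rw [this, hεm, hlam]; ring
  have e4 : θ ^ 7 * m ^ 7 ≤ 9216 * L ^ 2 * (1638400 * L ^ 8 * P) := by
    rw [e3]; exact mul_le_mul_of_nonneg_left e2 (by positivity)
  -- The seventh power is already controlled; the extra factor `m` is bounded by `3 L`.
  calc θ ^ 7 * m ^ 8 = θ ^ 7 * m ^ 7 * m := by ring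
    _ ≤ 9216 * L ^ 2 * (1638400 * L ^ 8 * P) * (3 * L) :=
        mul_le_mul e4 hmL hm (by positivity)
    _ = 45298483200 * (L ^ 11 * P) := by ring
    _ ≤ 50000000000 * (L ^ 11 * P) :=
        mul_le_mul_of_nonneg_right (by norm_num) (by positivity)
    _ = 50000000000 * L ^ 11 * P := by ring

/-- The gap between a solution and the viscosity solution, at one point. -/
theorem hopfLax_sub_pow_le (hL : 1 ≤ L) (hh : EuclideanLipschitzOn L h (closure Q))
    (hs : SolvesHJAE Q h) {μ : SignedRadonMeasure Q} (hμ : IsEntropyProduction Q (dx h) μ)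
    (hfin : μ.posPart Q ≠ ⊤) {t₁ : ℝ} (ht₀ : 0 ≤ t₁) (ht₁ : t₁ < 1) {z₁ : ℝ × ℝ} (hz₁ : z₁ ∈ Q)
    (hz₁t : z₁.1 ≤ t₁) :
    (1 - t₁) ^ 7 * (hopfLax h (4 * L) z₁ - h z₁) ^ 8 ≤
      50000000000 * L ^ 11 * (μ.posPart Q).toReal := by
  have hL0 : 0 < L := by linarith
  set m := hopfLax h (4 * L) z₁ - h z₁ with hm
  set θ := 1 - t₁ with hθ
  set P := (μ.posPart Q).toReal with hP
  have hP0 : 0 ≤ P := ENNReal.toReal_nonneg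
  have hθ0 : 0 < θ := sub_pos.2 ht₁
  have hθ1 : θ ≤ 1 := by rw [hθ]; linarith
  have hm0 : 0 ≤ m := sub_nonneg.2 (le_hopfLax hL0 hh hs (by linarith) (subset_closure hz₁))
  rcases hm0.eq_or_lt with h0 | hmp
  · rw [← h0]; simp only [ne_eq, OfNat.ofNat_ne_zero, not_false_eq_true, zero_pow, mul_zero]
    positivity
  have hgap : ∀ w ∈ closure Q, ∀ c, w.1 ≤ c ∨ w.2 ≤ c ∨ 1 - c ≤ w.2 →
      hopfLax h (4 * L) w - h w ≤ 3 * L * c := by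
    intro w hw c hc
    obtain ⟨ζ, hζ, hd⟩ := exists_mem_closedBoundary_near hw hc
    have h1 := hopfLax_le_of_mem_closedBoundary hL hh hs hw hζ
    have h2 := mul_le_mul_of_nonneg_left hd (by linarith : 0 ≤ 3 * L)
    linarith
  have hB : ∀ w ∈ closure Q, hopfLax h (4 * L) w - h w ≤ 3 * L := fun w hw => by
    simpa using hgap w hw 1 (Or.inl (mem_closure_Q.1 hw).1.2)
  have hmL : m ≤ 3 * L := hB z₁ (subset_closure hz₁)
  -- Within `2ρ` of the boundary the gap is at most `3 L · 2ρ = m θ/4`, and with `B = 3 L` also `2ρ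
  -- B ≤ m θ/2`. The choice of `ε` puts the doubled points within `3 L ε = ρ/2` in each coordinate.
  set ρ := m * θ / (24 * L) with hρ
  set ε := ρ / (6 * L) with hε
  have hρ0 : 0 < ρ := by positivity
  have hε0 : 0 < ε := by positivity
  have hρε : 6 * L * ε = ρ := by rw [hε]; field_simp
  have hρm : 24 * L * ρ = m * θ := by rw [hρ]; field_simp
  have hmθ : m * θ ≤ m := mul_le_of_le_one_right hm0 hθ1
  have hLε : 0 < L * ε := by positivity
  have hclose : ∀ z ∈ closure Q, ∀ w ∈ closure Q,
      ((z.1 - w.1) ^ 2 + (z.2 - w.2) ^ 2) / (2 * ε) ≤ h w - h z →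
        |z.1 - w.1| ≤ ρ ∧ |z.2 - w.2| ≤ ρ ∧ h w - h z ≤ m / 8 := by
    intro z hz w hw hzw
    have h1 := hh.le_add hL0.le hw hz
    rw [abs_sub_comm w.1, abs_sub_comm w.2] at h1
    have h2 := hzw.trans (sub_le_iff_le_add'.2 h1)
    rw [div_le_iff₀ (by positivity)] at h2
    obtain ⟨h3, h4⟩ := abs_le_of_sq_add_sq_le (x := z.1 - w.1) (y := z.2 - w.2) hLε (by linarith)
    refine ⟨by linarith, by linarith, ?_⟩
    have h5 : L * (|z.1 - w.1| + |z.2 - w.2|) ≤ L * (6 * L * ε) :=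
      mul_le_mul_of_nonneg_left (by linarith) hL0.le
    rw [hρε] at h5
    linarith
  have hbdry : ∀ w ∈ closure Q, w.1 ≤ 2 * ρ ∨ w.2 ≤ 2 * ρ ∨ 1 - 2 * ρ ≤ w.2 →
      hopfLax h (4 * L) w - h w ≤ m / 4 := by
    intro w hw hc
    have := hgap w hw _ hc
    linarith
  obtain ⟨z₀, p, hb1, hb2, hzp, hpe, hdef, htouch⟩ :=
    exists_touching_paraboloid (continuousOn_hopfLax hL hh hs)
      (hh.lipschitzOnWith hL0.le).continuousOn (isViscositySubsolution_hopfLax hL hh hs) hmp hρ0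
      ht₁ hz₁ hz₁t le_rfl hclose hbdry hB (by rw [← hθ]; linarith [mul_pos hmp hθ0]) hε0
  rw [← hθ] at hdef
  set lam := m * θ / 2 with hlam
  have hlam0 : 0 < lam := by positivity
  have hz₀ : z₀ ∈ closure Q := subset_closure
    (mem_Q_of_mem_closedBall hb1 hb2 (mem_closedBall_self hρ0.le))
  have hp : |p.1| ≤ 3 * L ∧ |p.2| ≤ 3 * L := by
    have h1 := hh.le_add hL0.le hzp hz₀
    simp only [Prod.fst_add, Prod.snd_add, Prod.smul_fst, Prod.smul_snd, smul_eq_mul,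
      add_sub_cancel_left, abs_mul, abs_of_pos hε0] at h1
    obtain ⟨h2, h3⟩ := abs_le_of_sq_add_sq_le (x := ε * p.1) (y := ε * p.2) hLε (by
      rw [abs_mul, abs_mul, abs_of_pos hε0]
      have h2 : ε * (p.1 ^ 2 + p.2 ^ 2) / 2 ≤ L * (ε * |p.1| + ε * |p.2|) := by linarith
      have h3 := mul_le_mul_of_nonneg_left h2 (by positivity : 0 ≤ 2 * ε)
      linarith)
    rw [abs_mul, abs_of_pos hε0] at h2 h3
    constructor
    · exact le_of_mul_le_mul_left (by linarith) hε0
    · exact le_of_mul_le_mul_left (by linarith) hε0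
  -- The largest radius for which the error from the curvature is absorbed by half of `lam²`.
  set r := lam ^ 2 * ε / (80 * L ^ 3) with hr
  have hr0 : 0 < r := by positivity
  have hrL : 80 * L ^ 3 * r = lam ^ 2 * ε := by rw [hr]; field_simp
  have hlamL : lam ≤ 2 * L := by linarith
  have hrε : r ≤ ε := by
    rw [hr, div_le_iff₀ (by positivity), mul_comm]
    refine mul_le_mul_of_nonneg_left ?_ hε0.le
    have h1 : lam ^ 2 ≤ (2 * L) ^ 2 := by gcongr
    have h2 : L ^ 2 * 1 ≤ L ^ 2 * L := mul_le_mul_of_nonneg_left hL (by positivity)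
    linarith [sq_nonneg L]
  have hrρ : r < ρ := by
    have : 1 * ε ≤ L * ε := mul_le_mul_of_nonneg_right hL hε0.le
    linarith
  have hkey := sq_mul_sq_le_of_touching hL hh hs hμ hfin hlam0 hε0 hr0 hrρ hrε
    (by linarith) hb1 hb2 hp.1 hp.2 hdef htouch
  exact gap_pow_le_of_estimate hL hm0 hε0 hP0 hmL
    (by rw [← hρm, ← hρε]; ring) hrL hkey

end BurgersHJ

/-! ### Extraction of the eighth root. -/

theorem mainTheorem4 (t₁ L : ℝ) (ht₁ : 0 ≤ t₁) (ht₁' : t₁ < 1) (hL : 1 ≤ L) :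
    ∃ C : ℝ, 0 < C ∧
      ∀ (h : ℝ × ℝ → ℝ) (μ : BurgersHJ.SignedRadonMeasure BurgersHJ.Q),
        BurgersHJ.EuclideanLipschitzOn L h (closure BurgersHJ.Q) →
        BurgersHJ.SolvesHJAE BurgersHJ.Q h →
        BurgersHJ.IsEntropyProduction BurgersHJ.Q (BurgersHJ.dx h) μ →
        ∃ hbar : ℝ × ℝ → ℝ,
          BurgersHJ.IsViscositySolutionWithData h hbar ∧
          (∀ v : ℝ × ℝ → ℝ, BurgersHJ.IsViscositySolutionWithData h v →
            EqOn v hbar (closure BurgersHJ.Q)) ∧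
          (⨆ z ∈ BurgersHJ.Q ∩ {z | z.1 ≤ t₁}, ENNReal.ofReal |h z - hbar z|) ≤
            ENNReal.ofReal C * (μ.posPart BurgersHJ.Q) ^ (1 / 8 : ℝ) := by
  have hθ : 0 < 1 - t₁ := sub_pos.2 ht₁'
  have hL0 : 0 < L := by linarith
  set C₀ : ℝ := 50000000000 * L ^ 11 / (1 - t₁) ^ 7 with hC₀
  have hC₀0 : 0 < C₀ := by positivity
  refine ⟨C₀ ^ (1 / 8 : ℝ), by positivity, fun h μ hh hs hμ => ?_⟩
  have hsol := BurgersHJ.isViscositySolutionWithData_hopfLax hL hh hs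
  refine ⟨BurgersHJ.hopfLax h (4 * L), hsol, fun v hv => hv.eqOn hsol, iSup₂_le fun z hz => ?_⟩
  by_cases hfin : μ.posPart BurgersHJ.Q = ⊤
  · rw [hfin, ENNReal.top_rpow_of_pos (by norm_num),
      ENNReal.mul_top (ENNReal.ofReal_pos.2 (by positivity)).ne']
    exact le_top
  have hkey := BurgersHJ.hopfLax_sub_pow_le hL hh hs hμ hfin ht₁ ht₁' hz.1 hz.2
  have hle := BurgersHJ.le_hopfLax hL0 hh hs (Λ := 4 * L) (by linarith) (subset_closure hz.1)
  rw [abs_sub_comm, abs_of_nonneg (sub_nonneg.2 hle)]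
  set m := BurgersHJ.hopfLax h (4 * L) z - h z
  set P := (μ.posPart BurgersHJ.Q).toReal with hP
  have hm0 : 0 ≤ m := sub_nonneg.2 hle
  have hP0 : 0 ≤ P := ENNReal.toReal_nonneg
  have h8 : m ^ 8 ≤ C₀ * P := by
    rw [hC₀, div_mul_eq_mul_div, le_div_iff₀ (by positivity), mul_comm]
    exact hkey
  have hm : m ≤ C₀ ^ (1 / 8 : ℝ) * P ^ (1 / 8 : ℝ) := by
    rw [← Real.mul_rpow hC₀0.le hP0]
    calc m = (m ^ 8) ^ (1 / 8 : ℝ) := by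
          rw [← Real.rpow_natCast, ← Real.rpow_mul hm0]; norm_num
      _ ≤ (C₀ * P) ^ (1 / 8 : ℝ) := Real.rpow_le_rpow (by positivity) h8 (by norm_num)
  refine (ENNReal.ofReal_le_ofReal hm).trans_eq ?_
  rw [ENNReal.ofReal_mul (by positivity), ← ENNReal.ofReal_rpow_of_nonneg hP0 (by norm_num), hP,
    ENNReal.ofReal_toReal hfin]
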